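/- Let $G$ be a connected simple real Lie group with finite center, $\mathfrak g=\mathrm{Lie}(G)$ with Killing form $\kappa$, $K$ a maximal compact subgroup of $G$, $\Theta$ the corresponding Cartan involution of $G$ (so that $K$ is its group of fixed points) and $\theta$ its differential. Assume that $G/K$ is Hermitian symmetric of tube type, in the following sense: there are a finite covering group $S$ of $PSL(2,\mathbb R)$ and a continuous homomorphism $\phi:S\to G$ such that, with $H=\phi(S)$, the group $H\cap K$ is contained with finite index in the center of $K$, and a basis $h,e,f$ of $\mathrm{Lie}(H)$ with $h \neq 0$, $[e,f]=h$, $[h,e]=2e$, $[h,f]=-2f$, such that $f=-\theta e$ and $\mathbb R(e-f)=\mathrm{Lie}(H\cap K)$. Put $M=\{g\in G\mid \mathrm{Ad}(g)h=h\}$, $\mathfrak n=\{X\in\mathfrak g\mid [h,X]=2X\}$, and let $N$ be the subgroup of $G$ generated by $\exp(\mathfrak n)$. Then $M^f:=\{m\in M\mid \mathrm{Ad}(m)f=f\}$ is equal to $K_M:=M\cap K$, and $K_M$ is compact. Moreover, for every real $t\ne 0$ there is a unique continuous unitary character $\chi$ of $N$ with $\chi(\exp X)=e^{it\kappa(f,X)}$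 for all $X\in\mathfrak n$; this character is generic, that is, its orbit under $M$ (acting on $N$ by conjugation) is open in the group of continuous unitary characters of $N$; and its stabilizer in $M$ is $K_M$. -/

import Mathlib

open scoped Manifold ContDiff MatrixGroups

noncomputable section LieGroupNotions

variable {d : ℕ} {G : Type*} [TopologicalSpace G] [ChartedSpace (EuclideanSpace ℝ (Fin d)) G]
  [Group G]

/-- Over `ℝ` the regularity required by Mathlib for the Lie bracket is `C^3`, so a smooth Lie group
has a Lie algebra `GroupLieAlgebra (𝓡 d) G`. -/
instance instLieGroupMinSmoothness [LieGroup (𝓡 d) ∞ G] :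
    LieGroup (𝓡 d) (minSmoothness ℝ 3) G := by
  rw [minSmoothness_of_isRCLikeNormedField]
  infer_instance

variable (d) in
/-- The differential at the identity of a map `F : G → G` with `F 1 = 1`, as an endomorphism of the
Lie algebra. -/
def diffOne (F : G → G) : GroupLieAlgebra (𝓡 d) G →L[ℝ] GroupLieAlgebra (𝓡 d) G :=
  mfderiv (𝓡 d) (𝓡 d) F 1

variable (d) in
/-- The adjoint representation: `Ad g` is the differential at `1` of `x ↦ g x g⁻¹`. -/
def Ad (g : G) : GroupLieAlgebra (𝓡 d) G →L[ℝ] GroupLieAlgebra (𝓡 d) G :=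
  diffOne d (fun x : G => g * x * g⁻¹)

/-- `γ` is the curve `t ↦ exp (t X)`: the integral curve through `1` of the left-invariant vector
field defined by `X`. -/
structure IsExpCurve (X : GroupLieAlgebra (𝓡 d) G) (γ : ℝ → G) : Prop where
  map_zero : γ 0 = 1
  isIntegralCurve : IsMIntegralCurve γ (mulInvariantVectorField X)

/-- `g = exp X`. -/
def IsExp (X : GroupLieAlgebra (𝓡 d) G) (g : G) : Prop :=
  ∃ γ : ℝ → G, IsExpCurve X γ ∧ γ 1 = g

variable (d) in
/-- The Lie algebra of a subgroup `L` of `G`: all `X` with `exp (t X) ∈ L` for every real `t`. -/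
def lieOf (L : Subgroup G) : Set (GroupLieAlgebra (𝓡 d) G) :=
  {X | ∃ γ : ℝ → G, IsExpCurve X γ ∧ ∀ t, γ t ∈ L}

/-- `K` is a maximal compact subgroup of `G`. -/
def IsMaximalCompact (K : Subgroup G) : Prop :=
  Maximal (fun L : Subgroup G => IsCompact (L : Set G)) K

/-- The center of the subgroup `K`, viewed as a subgroup of `G`. -/
def centerIn (K : Subgroup G) : Subgroup G := (Subgroup.center K).map K.subtype

/-- `p : S → PSL(2, ℝ)` is a finite covering of topological groups. -/
structure IsFiniteCovering {S : Type*} [Group S] [TopologicalSpace S] (p : S →* PSL(2, ℝ)) :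
    Prop where
  isCoveringMap : IsCoveringMap p
  surjective : Function.Surjective p
  finite_ker : Finite p.ker

variable [LieGroup (𝓡 d) ∞ G]

variable (d) in
/-- `Θ` is the (global) Cartan involution of `G` corresponding to `K`: a smooth involutive
automorphism with group of fixed points `K`, whose differential `θ` makes
`(X, Y) ↦ -κ(X, θ Y)` positive definite, `κ` being the Killing form. -/
structure IsCartanInvolution (K : Subgroup G) (Θ : G →* G) : Prop where
  contMDiff : ContMDiff (𝓡 d) (𝓡 d) ∞ Θ
  involutive : Function.Involutive Θ
  mem_iff : ∀ g : G, g ∈ K ↔ Θ g = g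
  posDef : ∀ X : GroupLieAlgebra (𝓡 d) G, X ≠ 0 →
    0 < -killingForm ℝ (GroupLieAlgebra (𝓡 d) G) X (diffOne d Θ X)

/-- The subgroup `H` (the image of a finite covering of `PSL(2, ℝ)`) and the standard basis
`h, e, f` of its Lie algebra exhibit `G/K` as Hermitian symmetric of tube type, compatibly with the
Cartan involution `Θ`: the subgroup `H ∩ K` is, up to finite index, the center of `K`. -/
structure IsTubeTypeTDS (K : Subgroup G) (Θ : G →* G) (H : Subgroup G)
    (h e f : GroupLieAlgebra (𝓡 d) G) : Prop where
  le_center : H ⊓ K ≤ centerIn K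
  finite_index : (H ⊓ K).relIndex (centerIn K) ≠ 0
  span_eq : (Submodule.span ℝ {h, e, f} : Set (GroupLieAlgebra (𝓡 d) G)) = lieOf d H
  sl2 : IsSl2Triple h e f
  f_eq : f = -diffOne d Θ e
  span_compact :
    (Submodule.span ℝ {e - f} : Set (GroupLieAlgebra (𝓡 d) G)) = lieOf d (H ⊓ K)

/-- The Levi factor `M = {g ∈ G | Ad(g) h = h}`. -/
def leviM (h : GroupLieAlgebra (𝓡 d) G) : Set G := {g | Ad d g h = h}

/-- `𝔫`, the eigenspace of `ad h` for the eigenvalue `2`. -/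
def lieN (h : GroupLieAlgebra (𝓡 d) G) : Set (GroupLieAlgebra (𝓡 d) G) :=
  {X | ⁅h, X⁆ = (2 : ℝ) • X}

/-- `N`, the subgroup of `G` generated by `exp 𝔫`. -/
def groupN (h : GroupLieAlgebra (𝓡 d) G) : Subgroup G :=
  Subgroup.closure {g | ∃ X ∈ lieN h, IsExp X g}

/-- `χ` is the unitary character `exp X ↦ e^{i t κ(f, X)}` (`X ∈ 𝔫`) of `N`, where `κ` is the
Killing form. -/
def IsCharacterOf (h f : GroupLieAlgebra (𝓡 d) G) (t : ℝ) (χ : PontryaginDual (groupN h)) : Prop :=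
  ∀ X ∈ lieN h, ∀ n : groupN h, IsExp X (n : G) →
    χ n = Circle.exp (t * killingForm ℝ (GroupLieAlgebra (𝓡 d) G) f X)

/-- `ψ = χ ∘ (n ↦ m n m⁻¹)` on `N` (in particular `m` conjugates `N` into itself). -/
def IsConjBy (h : GroupLieAlgebra (𝓡 d) G) (m : G) (χ ψ : PontryaginDual (groupN h)) : Prop :=
  ∀ n : groupN h, ∃ hn : m * (n : G) * m⁻¹ ∈ groupN h, ψ n = χ ⟨m * (n : G) * m⁻¹, hn⟩

/-- The stabilizer of the character `χ` of `N` in `M`. -/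
def charStabilizer (h : GroupLieAlgebra (𝓡 d) G) (χ : PontryaginDual (groupN h)) : Set G :=
  {m | m ∈ leviM h ∧ IsConjBy h m χ χ}

/-- `χ` is generic: its `M`-orbit is open in the group of unitary characters of `N`. -/
def IsGenericCharacter (h : GroupLieAlgebra (𝓡 d) G) (χ : PontryaginDual (groupN h)) : Prop :=
  IsOpen {ψ : PontryaginDual (groupN h) | ∃ m ∈ leviM h, IsConjBy h m χ ψ}

end LieGroupNotions

/-! Everything follows from one identity for `u = e - f`: the Cartan involution is `θ = 1 + ½ (ad
u)²`, that is, `(ad u)²` is `0` on the compact part and `-4` on the noncompact part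
(`cartanInvolution_eq`). The compact part is killed because `exp (t u)` is central in `K`. On the
noncompact part, the `-4`-eigenspace of `(ad u)²` contains `h`; its Killing complement there
commutes with it, and the centralizer of this complement is a nonzero ideal, so by simplicity the
complement is central, hence zero.

The identity has two consequences. First, an automorphism fixing `h` and `f` fixes `e` by
`sl₂`-theory, hence `u`, hence commutes with `θ`. So if `m ∈ M` fixes `f`, then `m⁻¹ Θ(m)` acts
trivially under `Ad` and is central; since the center is finite, the elements with this property
form a compact group containing `K`, which equals `K` by maximality. Conversely, `m ∈ M ∩ K` fixes
`u` and `[h, u] = 2 (e + f)`, hence `f`.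

Second, `θ² = 1` gives `(ad u)⁴ = -4 (ad u)²`, which excludes eigenvalues of `ad h` of absolute
value at least `4`. Therefore `𝔫` is abelian, `N = exp 𝔫`, and `X ↦ [X, f]` maps the centralizer of
`h` onto the `-2`-eigenspace. By the inverse function theorem the `M`-orbit of `f` contains a
neighborhood of `f` in that eigenspace. The Killing form pairs it perfectly with `𝔫`, so characters
of `N` near `1` correspond to its small vectors: the orbit of `χ` is open, and stabilizing `χ` means
fixing `f`.

The middle of the file supplies the Lie group theory needed for this: exponential curves, `Ad` and
its differential, and the centrality of its kernel. -/

section SlTwoRepresentations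

/-! ### Representations of `sl₂` and the bound on the eigenvalues of `ad h`. -/

variable {L : Type*} [LieRing L] [LieAlgebra ℝ L] {h e f : L}

/-- `ad f` maps the centralizer of `h` onto the lowest eigenspace of `ad h`. -/
lemma IsSl2Triple.exists_lie_f_eq (t : IsSl2Triple h e f) {Y : L} (hY : ⁅h, Y⁆ = -(2 : ℝ) • Y)
    (hfY : ⁅f, Y⁆ = 0) : ∃ X : L, ⁅h, X⁆ = 0 ∧ ⁅X, f⁆ = Y := by
  -- As `[f, Y] = 0`, the Jacobi identity gives `[f, [e, Y]] = -[h, Y] = 2 Y`, which fixes the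
  -- factor `-1/2`.
  refine ⟨-(1 / 2 : ℝ) • ⁅e, Y⁆, ?_, ?_⟩
  · rw [lie_smul, leibniz_lie, t.lie_h_e_smul ℝ, hY, smul_lie, lie_smul]
    module
  · have h1 : ⁅f, ⁅e, Y⁆⁆ = (2 : ℝ) • Y := by
      rw [leibniz_lie, hfY, lie_zero, add_zero, ← lie_skew f e, t.lie_e_f, neg_lie, hY, neg_smul,
        neg_neg]
    rw [smul_lie, ← lie_skew, h1]
    module

variable [Module.Finite ℝ L]

/-- The nilpositive element of an `sl₂`-triple is determined by the two others. -/
lemma IsSl2Triple.e_unique {e' : L} (t : IsSl2Triple h e f) (t' : IsSl2Triple h e' f) : e' = e := by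
  by_contra hne
  -- The difference commutes with `f`, so for the reversed triple `(-h, f, e)` it would be a highest
  -- weight vector of weight `-2`, but such weights are natural numbers.
  have P : IsSl2Triple.HasPrimitiveVectorWith t.symm (e' - e) (-2 : ℝ) := by
    refine ⟨sub_ne_zero.2 hne, ?_, ?_⟩
    · rw [neg_lie, lie_sub, t.lie_h_e_smul ℝ, t'.lie_h_e_smul ℝ, neg_smul, smul_sub]
    · rw [lie_sub, ← lie_skew, ← lie_skew f e, t.lie_e_f, t'.lie_e_f, sub_self]
  obtain ⟨n, hn⟩ := P.exists_nat
  have : (0 : ℝ) ≤ n := n.cast_nonneg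
  linarith

/-- If `ad (e - f)` is annihilated by `X ^ 4 + 4 X ^ 2` then `ad h` has no eigenvalue `≥ 4`. -/
lemma IsSl2Triple.eq_zero_of_lie_h (t : IsSl2Triple h e f)
    (hu : ∀ X : L, ⁅e - f, ⁅e - f, ⁅e - f, ⁅e - f, X⁆⁆⁆⁆ = -(4 : ℝ) • ⁅e - f, ⁅e - f, X⁆⁆)
    {a : ℝ} (ha : 4 ≤ a) {V : L} (hV : ⁅h, V⁆ = a • V) : V = 0 := by
  by_contra hV0
  have hfin : {μ | (LieAlgebra.ad ℝ L h).HasEigenvalue μ}.Finite :=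
    Module.End.finite_hasEigenvalue _
  have hmem {b : ℝ} {W : L} (hW : ⁅h, W⁆ = b • W) (hW0 : W ≠ 0) :
      (LieAlgebra.ad ℝ L h).HasEigenvalue b :=
    Module.End.hasEigenvalue_of_hasEigenvector
      (Module.End.hasEigenvector_iff.2 ⟨Module.End.mem_eigenspace_iff.2 hW, hW0⟩)
  -- A maximal eigenvalue `μ ≥ a` has highest weight vectors as its eigenvectors.
  obtain ⟨μ, haμ, hμ⟩ := hfin.exists_le_maximal (hmem hV hV0)
  obtain ⟨W, hW⟩ := hμ.prop.exists_hasEigenvector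
  have hhW : ⁅h, W⁆ = μ • W := Module.End.mem_eigenspace_iff.1 hW.1
  have P : IsSl2Triple.HasPrimitiveVectorWith t W μ := by
    refine ⟨hW.2, hhW, ?_⟩
    by_contra hne
    have h1 : ⁅h, ⁅e, W⁆⁆ = (μ + 2) • ⁅e, W⁆ := by
      rw [leibniz_lie, t.lie_h_e_smul ℝ, hhW, smul_lie, lie_smul, add_smul, add_comm]
    have := hμ.le_of_ge (hmem h1 hne) (by linarith)
    linarith
  let x (n : ℕ) : L := (LieModule.toEnd ℝ L L f ^ n) W
  have hf (n : ℕ) : ⁅f, x n⁆ = x (n + 1) := P.lie_f_pow_toEnd_f n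
  have he (n : ℕ) : ⁅e, x (n + 1)⁆ = ((n + 1) * (μ - n)) • x n := P.lie_e_pow_succ_toEnd_f n
  have he0 : ⁅e, x 0⁆ = 0 := P.lie_e
  have hx (n : ℕ) (hn : (n : ℝ) < μ) (hz : x (n + 1) = 0) : x n = 0 := by
    have h1 := he n
    rw [hz, lie_zero, eq_comm, smul_eq_zero] at h1
    refine h1.resolve_left (mul_ne_zero (by positivity) (by linarith))
  have e0 : ⁅e - f, x 0⁆ = -x 1 := by rw [sub_lie, he0, hf, zero_sub]
  have e1 : ⁅e - f, x 1⁆ = μ • x 0 - x 2 := by rw [sub_lie, he, hf]; simp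
  have e2 : ⁅e - f, x 2⁆ = (2 * (μ - 1)) • x 1 - x 3 := by
    rw [sub_lie, he, hf]; norm_num
  have e3 : ⁅e - f, x 3⁆ = (3 * (μ - 2)) • x 2 - x 4 := by
    rw [sub_lie, he, hf]; norm_num
  have hrel := hu (x 0)
  simp only [e0, e1, e2, e3, lie_neg, lie_sub, lie_smul] at hrel
  have hlin : x 4 = (2 * (μ - 1) + 3 * (μ - 2) + μ - 4) • x 2 -
      (μ * (μ + 2 * (μ - 1) - 4)) • x 0 := by
    linear_combination (norm := module) hrel
  have hh (n : ℕ) : ⁅h, x n⁆ = (μ - 2 * n) • x n := P.lie_h_pow_toEnd_f n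
  have h4 : x 4 = 0 := by
    -- The operator `(ad h - μ)(ad h - (μ - 4))` kills `x 0` and `x 2`, of weights `μ` and `μ - 4`,
    -- and multiplies `x 4`, of weight `μ - 8`, by `(-8)(-4) = 32`.
    have a1 := congrArg (fun y => ⁅h, ⁅h, y⁆⁆ - (2 * μ - 4) • ⁅h, y⁆ + (μ * (μ - 4)) • y) hlin
    simp only [lie_sub, lie_smul, hh] at a1
    have a2 : (32 : ℝ) • x 4 = 0 := by
      push_cast at a1
      linear_combination (norm := module) a1
    exact (smul_eq_zero.1 a2).resolve_left (by norm_num)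
  -- Descent from `x 4 = 0` to `x 0 = 0`: the coefficients `(n + 1)(μ - n)` do not vanish for `n ≤ 3
  -- < μ`.
  refine hW.2 (hx 0 ?_ (hx 1 ?_ (hx 2 ?_ (hx 3 ?_ h4)))) <;> push_cast <;> linarith

end SlTwoRepresentations

/-! ### The Cartan involution as a polynomial in `ad u`. -/

section CartanInvolutions

variable {L : Type*} [LieRing L] [LieAlgebra ℝ L]

local notation "κ" => killingForm ℝ L

lemma killingForm_lie_left (X Y Z : L) : κ ⁅X, Y⁆ Z = κ X ⁅Y, Z⁆ :=
  LieModule.traceForm_apply_lie_apply ℝ L L X Y Z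

variable [Module.Finite ℝ L] {θ : L ≃ₗ⁅ℝ⁆ L} {h e f u : L}

/-- For a Cartan involution `θ` of a simple Lie algebra, a compact element `u` that centralizes
the compact part and satisfies `(ad u)² h = -4 h` for a nonzero noncompact `h` determines `θ`. -/
lemma cartanInvolution_eq (hL : LieAlgebra.IsSimple ℝ L) (hθ : ∀ X, θ (θ X) = X)
    (hpos : ∀ X : L, X ≠ 0 → 0 < -κ X (θ X)) (hu : ∀ Z, θ Z = Z → ⁅u, Z⁆ = 0)
    (hh : h ≠ 0) (hθh : θ h = -h) (hJ : ⁅u, ⁅u, h⁆⁆ = -(4 : ℝ) • h) (X : L) :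
    θ X = X + (1 / 2 : ℝ) • ⁅u, ⁅u, X⁆⁆ := by
  let q₁ : Submodule ℝ L :=
    { carrier := {X | θ X = -X ∧ ⁅u, ⁅u, X⁆⁆ = -(4 : ℝ) • X}
      add_mem' := fun {X Y} hX hY => ⟨by rw [map_add, hX.1, hY.1]; abel, by
        rw [lie_add, lie_add, hX.2, hY.2, smul_add]⟩
      zero_mem' := by simp
      smul_mem' := fun c X hX => ⟨by rw [map_smul, hX.1, smul_neg], by
        rw [lie_smul, lie_smul, hX.2, smul_comm]⟩ }
  -- The Killing complement, within the noncompact part, of the vectors where the identity already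
  -- holds; the aim is to show that it vanishes.
  let q₂ : Set L := {Y | θ Y = -Y ∧ ∀ X ∈ q₁, κ X Y = 0}
  have hq₁ {Z X : L} (hZ : θ Z = Z) (hX : X ∈ q₁) : ⁅Z, X⁆ ∈ q₁ := by
    have hc (W : L) : ⁅u, ⁅Z, W⁆⁆ = ⁅Z, ⁅u, W⁆⁆ := by
      rw [leibniz_lie u Z W, hu Z hZ, zero_lie, zero_add]
    exact ⟨by rw [LieEquiv.map_lie, hZ, hX.1, lie_neg], by rw [hc, hc, hX.2, lie_smul]⟩
  have hq₂ {Z Y : L} (hZ : θ Z = Z) (hY : Y ∈ q₂) : ⁅Z, Y⁆ ∈ q₂ := by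
    refine ⟨by rw [LieEquiv.map_lie, hZ, hY.1, lie_neg], fun X hX => ?_⟩
    rw [← killingForm_lie_left, ← lie_skew, map_neg, LinearMap.neg_apply, hY.2 _ (hq₁ hZ hX),
      neg_zero]
  have hq₁₂ {X Y : L} (hX : X ∈ q₁) (hY : Y ∈ q₂) : ⁅X, Y⁆ = 0 := by
    by_contra hne
    have hW : θ ⁅X, Y⁆ = ⁅X, Y⁆ := by rw [LieEquiv.map_lie, hX.1, hY.1, neg_lie, lie_neg, neg_neg]
    -- `W = [X, Y]` is compact, so `κ(W, W) < 0` if `W ≠ 0`; but `κ(W, W) = κ(X, [Y, W])` vanishes,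
    -- since `[W, Y]` is again in `q₂`.
    have h1 := hpos _ hne
    rw [hW, killingForm_lie_left, ← lie_skew Y ⁅X, Y⁆, map_neg, (hq₂ hW hY).2 X hX] at h1
    simp at h1
  have hsplit (X : L) : ∃ a b c, θ a = a ∧ b ∈ q₁ ∧ c ∈ q₂ ∧ X = a + b + c := by
    have hdisj : Disjoint q₁ (LinearMap.BilinForm.orthogonal κ q₁) := by
      rw [Submodule.disjoint_def]
      intro Y hY hY'
      by_contra hne
      have h1 := hpos Y hne
      rw [hY.1, map_neg, LinearMap.BilinForm.mem_orthogonal_iff.1 hY' Y hY] at h1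
      simp at h1
    have hcompl := (LinearMap.BilinForm.isCompl_orthogonal_iff_disjoint
      (LieModule.traceForm_isSymm ℝ L L).isRefl).2 hdisj
    obtain ⟨b, hb, c, hc, hbc⟩ := Submodule.mem_sup.1
      (hcompl.sup_eq_top ▸ Submodule.mem_top : (1 / 2 : ℝ) • (X - θ X) ∈ q₁ ⊔ _)
    refine ⟨(1 / 2 : ℝ) • (X + θ X), b, c, ?_, hb, ⟨?_, fun Y hY => ?_⟩, ?_⟩
    · rw [map_smul, map_add, hθ, add_comm]
    · have : c = (1 / 2 : ℝ) • (X - θ X) - b := by rw [← hbc]; abel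
      rw [this, map_sub, map_smul, map_sub, hθ, hb.1]
      module
    · exact LinearMap.BilinForm.mem_orthogonal_iff.1 hc Y hY
    · rw [add_assoc, hbc]
      module
  have hzero {Y : L} (hY : ∀ X : L, ⁅X, Y⁆ = 0) : Y = 0 := by
    by_contra hne
    have h1 := hpos Y hne
    have h2 : LieAlgebra.ad ℝ L Y = 0 := by
      ext X
      rw [LieAlgebra.ad_apply, ← lie_skew, hY, neg_zero, LinearMap.zero_apply]
    rw [killingForm_apply_apply, h2] at h1
    simp at h1
  -- The centralizer of `q₂` is an ideal: the compact part normalizes `q₂`, `q₁` itself centralizes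
  -- `q₂`, and brackets with `q₂` vanish by definition.
  let I : LieIdeal ℝ L :=
    { carrier := {X | ∀ Y ∈ q₂, ⁅X, Y⁆ = 0}
      add_mem' := fun {X X'} hX hX' Y hY => by rw [add_lie, hX Y hY, hX' Y hY, add_zero]
      zero_mem' := fun Y _ => zero_lie Y
      smul_mem' := fun c X hX Y hY => by rw [smul_lie, hX Y hY, smul_zero]
      lie_mem := by
        intro x m hm Y hY
        obtain ⟨a, b, c, ha, hb, hc, rfl⟩ := hsplit x
        have h1 : ⁅m, ⁅a, Y⁆⁆ = 0 := hm _ (hq₂ ha hY)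
        have h2 : ⁅c, m⁆ = 0 := by rw [← lie_skew, hm c hc, neg_zero]
        have h3 : ⁅m, Y⁆ = 0 := hm Y hY
        rw [add_lie, h2, add_zero, lie_lie, h3, lie_zero, add_lie, lie_add, h1, hq₁₂ hb hY]
        simp }
  have hI : I = ⊤ := by
    refine (hL.eq_bot_or_eq_top I).resolve_left fun hbot => hh ?_
    have : h ∈ I := fun Y hY => hq₁₂ ⟨hθh, hJ⟩ hY
    rw [hbot] at this
    simpa using this
  have hq₂0 {Y : L} (hY : Y ∈ q₂) : Y = 0 :=
    hzero fun X => (hI ▸ LieSubmodule.mem_top X : X ∈ I) Y hY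
  obtain ⟨a, b, c, ha, hb, hc, rfl⟩ := hsplit X
  rw [hq₂0 hc, add_zero, map_add, ha, hb.1, lie_add, lie_add, hb.2, hu a ha, lie_zero, zero_add,
    smul_smul, add_assoc]
  congr 1
  module

end CartanInvolutions

/-! ### Derivatives and velocities, read in the fixed model space. -/

noncomputable section ModelDerivative

open Set Filter Topology

variable {d : ℕ} {G : Type*} [TopologicalSpace G] [ChartedSpace (EuclideanSpace ℝ (Fin d)) G]

local notation "𝔼" => EuclideanSpace ℝ (Fin d)

/-- The derivative of a self-map of `G`, as an endomorphism of the model space. -/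
def modelDeriv (F : G → G) (x : G) : 𝔼 →L[ℝ] 𝔼 := mfderiv (𝓡 d) (𝓡 d) F x

/-- `v` is the velocity of the curve `γ` at time `t`. -/
def HasVelocity (γ : ℝ → G) (v : 𝔼) (t : ℝ) : Prop :=
  HasMFDerivAt 𝓘(ℝ, ℝ) (𝓡 d) γ t ((1 : ℝ →L[ℝ] ℝ).smulRight v)

lemma HasMFDerivAt.hasVelocity {γ : ℝ → G} {v : 𝔼} {t : ℝ} {L : ℝ →L[ℝ] 𝔼}
    (h : HasMFDerivAt 𝓘(ℝ, ℝ) (𝓡 d) γ t L) (hL : L 1 = v) : HasVelocity γ v t := by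
  obtain rfl : L = (1 : ℝ →L[ℝ] ℝ).smulRight v := by ext1; simp [hL]
  exact h

lemma modelDeriv_comp {F H : G → G} {x : G} (hF : MDifferentiableAt (𝓡 d) (𝓡 d) F (H x))
    (hH : MDifferentiableAt (𝓡 d) (𝓡 d) H x) :
    modelDeriv (d := d) (F ∘ H) x = (modelDeriv F (H x)).comp (modelDeriv H x) :=
  mfderiv_comp x hF hH

lemma modelDeriv_id (x : G) : modelDeriv (d := d) (id : G → G) x = .id ℝ _ := mfderiv_id

lemma HasVelocity.comp {γ : ℝ → G} {v : 𝔼} {t : ℝ} (hγ : HasVelocity γ v t) {F : G → G}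
    (hF : MDifferentiableAt (𝓡 d) (𝓡 d) F (γ t)) :
    HasVelocity (F ∘ γ) (modelDeriv F (γ t) v) t :=
  (HasMFDerivAt.comp t hF.hasMFDerivAt hγ).hasVelocity
    (congrArg (modelDeriv (d := d) F (γ t)) (one_smul ℝ v))

lemma HasVelocity.scomp {γ : ℝ → G} {v : 𝔼} {t : ℝ} {c : ℝ → ℝ} {c' : ℝ}
    (hγ : HasVelocity γ v (c t)) (hc : HasDerivAt c c' t) :
    HasVelocity (γ ∘ c) (c' • v) t :=
  (HasMFDerivAt.comp t hγ hc.hasFDerivAt.hasMFDerivAt).hasVelocity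
    (congrArg (· • v) (one_smul ℝ c'))

lemma HasVelocity.continuousAt {γ : ℝ → G} {v : 𝔼} {t : ℝ} (hγ : HasVelocity γ v t) :
    ContinuousAt γ t := HasMFDerivAt.continuousAt hγ

lemma HasVelocity.unique {γ : ℝ → G} {v w : 𝔼} {t : ℝ} (hv : HasVelocity γ v t)
    (hw : HasVelocity γ w t) : v = w := by
  have h := hasMFDerivAt_unique hv hw
  have h1 : (1 : ℝ) • v = (1 : ℝ) • w := congrArg (fun L : ℝ →L[ℝ] 𝔼 => L 1) h
  simpa using h1

lemma HasVelocity.congr_velocity {γ : ℝ → G} {v w : 𝔼} {t : ℝ} (hv : HasVelocity γ v t)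
    (h : v = w) : HasVelocity γ w t := h ▸ hv

end ModelDerivative

/-! ### Exponential curves as one-parameter subgroups. -/

noncomputable section ExponentialCurves

open Set Filter Topology

variable {d : ℕ} {G : Type*} [TopologicalSpace G] [ChartedSpace (EuclideanSpace ℝ (Fin d)) G]
  [Group G]

local notation "𝔤" => GroupLieAlgebra (𝓡 d) G
local notation "𝔼" => EuclideanSpace ℝ (Fin d)

instance instFiniteGroupLieAlgebra : Module.Finite ℝ (GroupLieAlgebra (𝓡 d) G) :=
  inferInstanceAs (Module.Finite ℝ (EuclideanSpace ℝ (Fin d)))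

lemma isExpCurve_iff {X : 𝔤} {γ : ℝ → G} :
    IsExpCurve X γ ↔ γ 0 = 1 ∧
      ∀ t, HasVelocity γ (modelDeriv (d := d) (fun x : G => γ t * x) 1 X) t :=
  ⟨fun h => ⟨h.1, h.2⟩, fun h => ⟨h.1, h.2⟩⟩

lemma IsExpCurve.hasVelocity {X : 𝔤} {γ : ℝ → G} (h : IsExpCurve X γ) (t : ℝ) :
    HasVelocity γ (modelDeriv (d := d) (fun x : G => γ t * x) 1 X) t := (isExpCurve_iff.1 h).2 t

lemma IsExpCurve.hasVelocity_zero {X : 𝔤} {γ : ℝ → G} (h : IsExpCurve X γ) :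
    HasVelocity γ (X : 𝔼) 0 := by
  refine (h.hasVelocity 0).congr_velocity ?_
  have : (fun x : G => γ 0 * x) = id := by ext; simp [h.1]
  rw [this, modelDeriv_id]; rfl

lemma IsExpCurve.continuous {X : 𝔤} {γ : ℝ → G} (h : IsExpCurve X γ) : Continuous γ :=
  continuous_iff_continuousAt.2 fun t => (h.hasVelocity t).continuousAt

variable [LieGroup (𝓡 d) ∞ G]

variable (d G) in
lemma LieGroup.isManifold_one : IsManifold (𝓡 d) 1 G :=
  have : IsManifold (𝓡 d) ∞ G := LieGroup.toContMDiffMul.toIsManifold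
  .of_le (n := ∞) (by simp)

lemma mdiff_mul_left (g x : G) : MDifferentiableAt (𝓡 d) (𝓡 d) (fun x : G => g * x) x :=
  (contMDiff_mul_left (I := 𝓡 d) (n := ∞)).mdifferentiable (by simp) x

lemma mdiff_mul_right (g x : G) : MDifferentiableAt (𝓡 d) (𝓡 d) (fun x : G => x * g) x :=
  (contMDiff_mul_right (I := 𝓡 d) (n := ∞)).mdifferentiable (by simp) x

lemma contMDiff_conj (g : G) : ContMDiff (𝓡 d) (𝓡 d) ∞ (MulAut.conj g : G → G) :=
  (contMDiff_mul_right (I := 𝓡 d) (n := ∞) (a := g⁻¹)).comp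
    (contMDiff_mul_left (I := 𝓡 d) (n := ∞) (a := g))

lemma modelDeriv_mul_left_mul (g x : G) :
    modelDeriv (d := d) (fun y : G => g * x * y) 1 =
      (modelDeriv (fun y : G => g * y) x).comp (modelDeriv (fun y : G => x * y) 1) := by
  have h := modelDeriv_comp (d := d) (F := fun y : G => g * y) (H := fun y : G => x * y) (x := 1)
    (mdiff_mul_left g _) (mdiff_mul_left x _)
  have e : (fun y : G => g * y) ∘ (fun y : G => x * y) = fun y => g * x * y := by
    ext y; simp [mul_assoc]
  rw [← e, h, mul_one]

/-- A smooth homomorphism intertwines left-invariant vector fields. -/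
lemma modelDeriv_hom_comp_mul_left (F : G →* G) (hF : MDifferentiable (𝓡 d) (𝓡 d) F) (x : G) :
    (modelDeriv (d := d) F x).comp (modelDeriv (fun y : G => x * y) 1) =
      (modelDeriv (fun y : G => F x * y) 1).comp (modelDeriv F 1) := by
  have h := modelDeriv_comp (d := d) (F := F) (H := fun y : G => x * y) (x := 1)
    (hF _) (mdiff_mul_left x _)
  have h' := modelDeriv_comp (d := d) (F := fun y : G => F x * y) (H := F) (x := 1)
    (mdiff_mul_left _ _) (hF _)
  have e : F ∘ (fun y : G => x * y) = (fun y : G => F x * y) ∘ F := by ext y; simp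
  rw [mul_one] at h
  rw [map_one] at h'
  rw [← h, ← h', e]

lemma contMDiff_one_mulInvariantVectorField (X : 𝔤) :
    ContMDiff (𝓡 d) (𝓡 d).tangent 1
      (fun g : G => (⟨g, mulInvariantVectorField X g⟩ : TangentBundle (𝓡 d) G)) :=
  (contMDiff_mulInvariantVectorField (I := 𝓡 d) X).of_le (by
    rw [minSmoothness_of_isRCLikeNormedField]; norm_num)

/-- A one-parameter subgroup with velocity `X` at time `0` is the exponential curve of `X`. -/
lemma isExpCurve_of_hom {X : 𝔤} {γ : ℝ → G} (hγ : ∀ s t, γ (s + t) = γ s * γ t)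
    (hX : HasVelocity γ (X : 𝔼) 0) : IsExpCurve X γ := by
  have h0 : γ 0 = 1 := by simpa using hγ 0 0
  refine isExpCurve_iff.2 ⟨h0, fun t => ?_⟩
  have h1 : HasVelocity (γ ∘ fun r => r - t) (X : 𝔼) t := by
    have := HasVelocity.scomp (γ := γ) (v := (X : 𝔼)) (t := t) (c := fun r => r - t) (c' := 1)
      (by simpa using hX) ((hasDerivAt_id t).sub_const t)
    exact this.congr_velocity (one_smul ℝ (X : 𝔼))
  have h2 := h1.comp (mdiff_mul_left (γ t) _)
  have e : (fun x => γ t * x) ∘ (γ ∘ fun r => r - t) = γ := by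
    ext r; simp [← hγ]
  rw [e] at h2
  simpa [h0] using h2

/-- Left translates of integral curves of left-invariant fields are integral curves. -/
lemma IsMIntegralCurveOn.mul_left_mulInvariant {X : 𝔤} {γ : ℝ → G} {s : Set ℝ} (hs : IsOpen s)
    (h : IsMIntegralCurveOn γ (mulInvariantVectorField X) s) (g : G) :
    IsMIntegralCurveOn (fun t => g * γ t) (mulInvariantVectorField X) s := by
  intro t ht
  have h1 : HasVelocity γ (modelDeriv (d := d) (fun x : G => γ t * x) 1 X) t :=
    (h t ht).hasMFDerivAt (hs.mem_nhds ht)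
  have h2 := h1.comp (mdiff_mul_left g _)
  refine HasMFDerivAt.hasMFDerivWithinAt (h2.congr_velocity ?_)
  exact (congrArg (fun L : 𝔼 →L[ℝ] 𝔼 => L X) (modelDeriv_mul_left_mul g (γ t))).symm

/-- The derivative of the multiplication at `(1, 1)` is addition. -/
lemma hasVelocity_mul {γ γ' : ℝ → G} {v w : 𝔼} (h : HasVelocity γ v 0) (h' : HasVelocity γ' w 0)
    (h0 : γ 0 = 1) (h0' : γ' 0 = 1) : HasVelocity (fun t => γ t * γ' t) (v + w) 0 := by
  have hm : MDifferentiableAt ((𝓡 d).prod (𝓡 d)) (𝓡 d) (fun p : G × G => p.1 * p.2)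
      (γ 0, γ' 0) := (contMDiff_mul (𝓡 d) ∞).mdifferentiable (by simp) _
  have hp : HasMFDerivAt 𝓘(ℝ, ℝ) ((𝓡 d).prod (𝓡 d)) (fun t => (γ t, γ' t)) 0 _ :=
    HasMFDerivAt.prodMk h h'
  refine (HasMFDerivAt.comp 0 hm.hasMFDerivAt hp).hasVelocity ?_
  refine (mfderiv_prod_eq_add_apply hm (v := ((1 : ℝ) • v, (1 : ℝ) • w))).trans ?_
  have e1 : (fun x : G => x * γ' 0) = id := by ext; simp [h0']
  have e2 : (fun x : G => γ 0 * x) = id := by ext; simp [h0]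
  dsimp only
  rw [e1, e2, mfderiv_id, mfderiv_id]
  exact congrArg₂ (· + ·) (one_smul ℝ v) (one_smul ℝ w)

variable [T2Space G]

lemma IsExpCurve.unique {X : 𝔤} {γ γ' : ℝ → G} (h : IsExpCurve X γ) (h' : IsExpCurve X γ') :
    γ = γ' := by
  have := LieGroup.isManifold_one d G
  exact isMIntegralCurve_Ioo_eq_of_contMDiff_boundaryless (I := 𝓡 d) (t₀ := 0)
    (contMDiff_one_mulInvariantVectorField X) h.2 h'.2 (h.1.trans h'.1.symm)

lemma IsExpCurve.map_add {X : 𝔤} {γ : ℝ → G} (h : IsExpCurve X γ) (s t : ℝ) :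
    γ (s + t) = γ s * γ t := by
  have := LieGroup.isManifold_one d G
  have h1 : IsMIntegralCurve (γ ∘ (· + s)) (mulInvariantVectorField X) := h.2.comp_add s
  have h2 : IsMIntegralCurve (fun t => γ s * γ t) (mulInvariantVectorField X) := by
    rw [isMIntegralCurve_iff_isMIntegralCurveOn]
    exact (h.2.isMIntegralCurveOn univ).mul_left_mulInvariant isOpen_univ _
  have := isMIntegralCurve_Ioo_eq_of_contMDiff_boundaryless (I := 𝓡 d) (t₀ := 0)
    (contMDiff_one_mulInvariantVectorField X) h1 h2 (by simp [h.1])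
  simpa [add_comm] using congrFun this t

/-- Left translates of a local integral curve through `1` give integral curves through every point
on the same time interval, and a uniform existence time makes the field complete. -/
lemma exists_isExpCurve (X : 𝔤) : ∃ γ : ℝ → G, IsExpCurve X γ := by
  have := LieGroup.isManifold_one d G
  obtain ⟨γ, hγ, hloc⟩ := exists_isMIntegralCurveAt_of_contMDiffAt_boundaryless (I := 𝓡 d) (t₀ := 0)
    (contMDiff_one_mulInvariantVectorField X).contMDiffAt (x₀ := (1 : G))
  obtain ⟨ε, hε, hon⟩ := isMIntegralCurveAt_iff'.1 hloc
  rw [Real.ball_eq_Ioo, zero_sub, zero_add] at hon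
  obtain ⟨γ', h0, h'⟩ := exists_isMIntegralCurve_of_isMIntegralCurveOn (I := 𝓡 d)
    (contMDiff_one_mulInvariantVectorField X) hε
    (fun x => ⟨fun t => x * γ t, by simp [hγ], hon.mul_left_mulInvariant isOpen_Ioo x⟩) (1 : G)
  exact ⟨γ', h0, h'⟩

lemma IsExpCurve.map {X : 𝔤} {γ : ℝ → G} (h : IsExpCurve X γ) (F : G →* G)
    (hF : MDifferentiable (𝓡 d) (𝓡 d) F) : IsExpCurve (diffOne d F X) (F ∘ γ) := by
  refine isExpCurve_of_hom (fun s t => by simp [h.map_add]) ?_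
  have := h.hasVelocity_zero.comp (hF (γ 0))
  rw [h.1] at this
  exact this

lemma IsExpCurve.smul {X : 𝔤} {γ : ℝ → G} (h : IsExpCurve X γ) (c : ℝ) :
    IsExpCurve (c • X) (fun t => γ (c * t)) := by
  refine isExpCurve_of_hom (fun s t => by rw [mul_add, h.map_add]) ?_
  refine HasVelocity.scomp (γ := γ) (v := (X : 𝔼)) (c := fun t => c * t) (c' := c)
    (by simpa using h.hasVelocity_zero) ?_
  simpa using (hasDerivAt_id (0 : ℝ)).const_mul c

lemma IsExpCurve.add {X Y : 𝔤} {γ γ' : ℝ → G} (h : IsExpCurve X γ) (h' : IsExpCurve Y γ')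
    (hc : ∀ s t, Commute (γ s) (γ' t)) : IsExpCurve (X + Y) (fun t => γ t * γ' t) := by
  refine isExpCurve_of_hom (fun s t => ?_)
    (hasVelocity_mul h.hasVelocity_zero h'.hasVelocity_zero h.1 h'.1)
  rw [h.map_add, h'.map_add, mul_assoc, mul_assoc, ← mul_assoc (γ t), (hc t s).eq, mul_assoc]

end ExponentialCurves

/-! ### The adjoint representation by Lie algebra automorphisms. -/

noncomputable section AdjointRepresentation

open Set Filter Topology

variable {d : ℕ} {G : Type*} [TopologicalSpace G] [ChartedSpace (EuclideanSpace ℝ (Fin d)) G]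
  [Group G]

local notation "𝔤" => GroupLieAlgebra (𝓡 d) G
local notation "𝔼" => EuclideanSpace ℝ (Fin d)

lemma Ad_eq_diffOne (g : G) : Ad d g = diffOne d ((MulAut.conj g).toMonoidHom : G →* G) := rfl

lemma diffOne_comp (F H : G →* G) (hF : MDifferentiable (𝓡 d) (𝓡 d) F)
    (hH : MDifferentiable (𝓡 d) (𝓡 d) H) (X : 𝔤) :
    diffOne d (F.comp H) X = diffOne d F (diffOne d H X) := by
  have := modelDeriv_comp (d := d) (F := F) (H := H) (x := 1) (hF _) (hH _)
  rw [map_one] at this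
  exact congrArg (fun L : 𝔼 →L[ℝ] 𝔼 => L X) this

lemma diffOne_id (X : 𝔤) : diffOne d (MonoidHom.id G) X = X :=
  congrArg (fun L : 𝔼 →L[ℝ] 𝔼 => L X) (modelDeriv_id (d := d) (1 : G))

lemma Ad_one_apply (X : 𝔤) : Ad d (1 : G) X = X := by
  refine Eq.trans ?_ (diffOne_id X)
  rw [Ad_eq_diffOne]
  congr 2
  ext x
  simp

variable [LieGroup (𝓡 d) ∞ G]

lemma mdiff_conj (g : G) :
    MDifferentiable (𝓡 d) (𝓡 d) ((MulAut.conj g).toMonoidHom : G →* G) :=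
  (contMDiff_conj g).mdifferentiable (by simp)

lemma Ad_mul_apply (g g' : G) (X : 𝔤) : Ad d (g * g') X = Ad d g (Ad d g' X) := by
  rw [Ad_eq_diffOne, Ad_eq_diffOne, Ad_eq_diffOne, ← diffOne_comp _ _ (mdiff_conj g) (mdiff_conj g')]
  congr 2
  ext x
  simp [mul_assoc]

lemma Ad_inv_apply_Ad (g : G) (X : 𝔤) : Ad d g⁻¹ (Ad d g X) = X := by
  rw [← Ad_mul_apply, inv_mul_cancel, Ad_one_apply]

lemma Ad_apply_Ad_inv (g : G) (X : 𝔤) : Ad d g (Ad d g⁻¹ X) = X := by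
  rw [← Ad_mul_apply, mul_inv_cancel, Ad_one_apply]

/-- The differential of a smooth automorphism respects the Lie bracket. -/
lemma diffOne_lie (F : G ≃* G) (hF : ContMDiff (𝓡 d) (𝓡 d) ∞ F)
    (hF' : ContMDiff (𝓡 d) (𝓡 d) ∞ F.symm) (X Y : 𝔤) :
    diffOne d F ⁅X, Y⁆ = ⁅diffOne d F X, diffOne d F Y⁆ := by
  have hd := hF.mdifferentiable (by simp)
  have hd' := hF'.mdifferentiable (by simp)
  have key (x : G) : (modelDeriv (d := d) F.symm (F x)).comp (modelDeriv F x) = .id ℝ _ := by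
    rw [← modelDeriv_comp (hd' _) (hd _)]
    have : (F.symm : G → G) ∘ F = id := by ext; simp
    rw [this, modelDeriv_id]
  have key' (x : G) : (modelDeriv (d := d) F x).comp (modelDeriv F.symm (F x)) = .id ℝ _ := by
    have := modelDeriv_comp (d := d) (F := F) (H := F.symm) (x := F x) (hd _) (hd' _)
    rw [F.symm_apply_apply] at this
    rw [← this]
    have : (F : G → G) ∘ F.symm = id := by ext; simp
    rw [this, modelDeriv_id]
  have hinv (x : G) : (mfderiv (𝓡 d) (𝓡 d) F x).inverse = mfderiv (𝓡 d) (𝓡 d) F.symm (F x) :=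
    ContinuousLinearMap.inverse_eq (key' x) (key x)
  -- Left-invariant fields pull back to left-invariant fields, so the claim is the naturality of the
  -- bracket of vector fields, evaluated at `1`.
  have hpull (Z : 𝔤) : VectorField.mpullback (𝓡 d) (𝓡 d) F
      (mulInvariantVectorField (diffOne d F Z)) = mulInvariantVectorField Z := by
    funext x
    rw [VectorField.mpullback_apply, hinv]
    have h1 := congrArg (fun L : 𝔼 →L[ℝ] 𝔼 => L Z)
      (modelDeriv_hom_comp_mul_left (d := d) F.toMonoidHom hd x)
    have h2 := congrArg (fun L : 𝔼 →L[ℝ] 𝔼 => L (modelDeriv (d := d) (fun y : G => x * y) 1 Z))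
      (key x)
    exact (congrArg (modelDeriv (d := d) F.symm (F x)) h1.symm).trans h2
  have hb := VectorField.mpullback_mlieBracket (I := 𝓡 d) (I' := 𝓡 d) (f := F) (x₀ := (1 : G))
    (n := ∞) (V := mulInvariantVectorField (diffOne d F X))
    (W := mulInvariantVectorField (diffOne d F Y))
    (mdifferentiableAt_mulInvariantVectorField _) (mdifferentiableAt_mulInvariantVectorField _)
    hF.contMDiffAt (by rw [minSmoothness_of_isRCLikeNormedField]; norm_cast)
  rw [hpull, hpull, VectorField.mpullback_apply, hinv] at hb
  let B : G → 𝔼 := VectorField.mlieBracket (𝓡 d) (mulInvariantVectorField (diffOne d F X))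
    (mulInvariantVectorField (diffOne d F Y))
  have h1 : modelDeriv (d := d) F.symm (F 1) (B (F 1)) = (⁅X, Y⁆ : 𝔤) := hb
  have h2 := congrArg (fun L : 𝔼 →L[ℝ] 𝔼 => L (B (F 1))) (key' 1)
  have h3 : modelDeriv (d := d) F 1 (⁅X, Y⁆ : 𝔤) = B (F 1) := by rw [← h1]; exact h2
  rw [map_one] at h3
  exact h3

lemma Ad_lie (g : G) (X Y : 𝔤) : Ad d g ⁅X, Y⁆ = ⁅Ad d g X, Ad d g Y⁆ :=
  diffOne_lie (MulAut.conj g) (contMDiff_conj g) (by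
    rw [← MulAut.inv_def, ← map_inv]
    exact contMDiff_conj g⁻¹) X Y

/-- The adjoint action as a group of automorphisms of the Lie algebra. -/
def AdEquiv (g : G) : 𝔤 ≃ₗ⁅ℝ⁆ 𝔤 where
  toFun := Ad d g
  map_add' := map_add _
  map_smul' := map_smul _
  map_lie' := Ad_lie g _ _
  invFun := Ad d g⁻¹
  left_inv := Ad_inv_apply_Ad g
  right_inv := Ad_apply_Ad_inv g

end AdjointRepresentation

/-! ### Second-order expansion of a local multiplication. -/

section PartialDerivatives

open Set Filter Topology

variable {E : Type*} [NormedAddCommGroup E] [NormedSpace ℝ E] [CompleteSpace E]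

/-- If `A x` conjugates the two partial derivatives of a local multiplication `m` at the unit `a`,
then its derivative at `a` is the commutator of the mixed second derivative of `m`. -/
lemma exists_hasFDerivAt_of_partial_fderiv {m : E × E → E} {a : E} (hm : ContDiffAt ℝ 2 m (a, a))
    {A : E → E →L[ℝ] E}
    (h1 : (fderiv ℝ m (a, a)).comp (.inl ℝ E E) = .id ℝ E)
    (h2 : (fderiv ℝ m (a, a)).comp (.inr ℝ E E) = .id ℝ E)
    (hA : ∀ᶠ x in 𝓝 a, (fderiv ℝ m (x, a)).comp (.inr ℝ E E) =
      ((fderiv ℝ m (a, x)).comp (.inl ℝ E E)).comp (A x)) :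
    ∃ A' : E →L[ℝ] E →L[ℝ] E, HasFDerivAt A A' a ∧ ∀ X Y, A' X Y =
      fderiv ℝ (fun x => fderiv ℝ m (x, a) (0, Y)) a X -
        fderiv ℝ (fun x => fderiv ℝ m (x, a) (0, X)) a Y := by
  have hd : DifferentiableAt ℝ (fderiv ℝ m) (a, a) :=
    (hm.fderiv_right (m := 1) (by norm_num)).differentiableAt (by simp)
  have hsymm : IsSymmSndFDerivAt ℝ m (a, a) := hm.isSymmSndFDerivAt (by simp)
  set B := fderiv ℝ (fderiv ℝ m) (a, a) with hB
  have hl : HasFDerivAt (fun x : E => fderiv ℝ m (x, a)) (B.comp (.inl ℝ E E)) a :=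
    HasFDerivAt.comp a (f := fun x : E => (x, a)) hd.hasFDerivAt
      (hasFDerivAt_prodMk_left a a)
  have hr : HasFDerivAt (fun x : E => fderiv ℝ m (a, x)) (B.comp (.inr ℝ E E)) a :=
    HasFDerivAt.comp a (f := fun x : E => (a, x)) hd.hasFDerivAt
      (hasFDerivAt_prodMk_right a a)
  have hD2 : HasFDerivAt (fun x : E => (fderiv ℝ m (x, a)).comp (.inr ℝ E E))
      (((ContinuousLinearMap.compL ℝ E (E × E) E).flip (.inr ℝ E E)).comp
        (B.comp (.inl ℝ E E))) a :=
    ((ContinuousLinearMap.compL ℝ E (E × E) E).flip (.inr ℝ E E)).hasFDerivAt.comp a hl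
  have hD1 : HasFDerivAt (fun x : E => (fderiv ℝ m (a, x)).comp (.inl ℝ E E))
      (((ContinuousLinearMap.compL ℝ E (E × E) E).flip (.inl ℝ E E)).comp
        (B.comp (.inr ℝ E E))) a :=
    ((ContinuousLinearMap.compL ℝ E (E × E) E).flip (.inl ℝ E E)).hasFDerivAt.comp a hr
  have hunit : ∀ᶠ x in 𝓝 a, IsUnit ((fderiv ℝ m (a, x)).comp (.inl ℝ E E)) := by
    refine hD1.continuousAt.eventually (Units.isOpen.mem_nhds ?_)
    change IsUnit ((fderiv ℝ m (a, a)).comp (.inl ℝ E E))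
    rw [h1]; exact isUnit_one
  have hAeq : ∀ᶠ x in 𝓝 a, A x = Ring.inverse ((fderiv ℝ m (a, x)).comp (.inl ℝ E E)) *
      (fderiv ℝ m (x, a)).comp (.inr ℝ E E) := by
    filter_upwards [hA, hunit] with x hx hu
    rw [hx]
    have := Ring.inverse_mul_cancel_left _ (A x) hu
    exact this.symm
  have hinv : DifferentiableAt ℝ
      (fun x => Ring.inverse ((fderiv ℝ m (a, x)).comp (.inl ℝ E E))) a := by
    have : DifferentiableAt ℝ (Ring.inverse : (E →L[ℝ] E) → _)
        ((fderiv ℝ m (a, a)).comp (.inl ℝ E E)) := by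
      rw [h1]
      exact differentiableAt_inverse isUnit_one
    exact this.comp a hD1.differentiableAt
  have hAd : DifferentiableAt ℝ A a :=
    (hinv.mul hD2.differentiableAt).congr_of_eventuallyEq hAeq
  have hAa : A a = .id ℝ E := by
    have := hA.self_of_nhds
    rw [h1, h2] at this
    simpa using this.symm
  refine ⟨fderiv ℝ A a, hAd.hasFDerivAt, fun X Y => ?_⟩
  -- Both sides of `hA` are differentiated at `a`; the derivative of the first factor on the right,
  -- rewritten by symmetry of the second derivative, is the subtracted term.
  have hprod := hD1.clm_comp hAd.hasFDerivAt
  have huniq := (hprod.congr_of_eventuallyEq hA).unique hD2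
  have hXY := congrArg (fun L : E →L[ℝ] E →L[ℝ] E => L X Y) huniq
  have e (Z : E) : fderiv ℝ (fun x => fderiv ℝ m (x, a) (0, Z)) a = 
      (ContinuousLinearMap.apply ℝ E ((0, Z) : E × E)).comp (B.comp (.inl ℝ E E)) :=
    ((ContinuousLinearMap.apply ℝ E ((0, Z) : E × E)).hasFDerivAt.comp a hl).fderiv
  rw [e, e]
  simp [h1, hAa] at hXY ⊢
  rw [← hXY, hsymm (Y, 0) (0, X)]
  abel

end PartialDerivatives

/-! ### The differential of `Ad` is the bracket. -/

noncomputable section AdjointDerivative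

open Set Filter Topology

variable {d : ℕ} {G : Type*} [TopologicalSpace G] [ChartedSpace (EuclideanSpace ℝ (Fin d)) G]
  [Group G]

local notation "𝔤" => GroupLieAlgebra (𝓡 d) G
local notation "𝔼" => EuclideanSpace ℝ (Fin d)

variable (d G) in
/-- The unit of `G` in the preferred chart at `1`. -/
def chartOne : 𝔼 := extChartAt (𝓡 d) (1 : G) 1

lemma extChartAt_symm_chartOne : (extChartAt (𝓡 d) (1 : G)).symm (chartOne d G) = 1 :=
  extChartAt_to_inv (I := 𝓡 d) (1 : G)

lemma eventually_chart_target :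
    ∀ᶠ x in 𝓝 (chartOne d G), x ∈ (extChartAt (𝓡 d) (1 : G)).target :=
  extChartAt_target_mem_nhds (I := 𝓡 d) (1 : G)

variable (d G) in
/-- The multiplication of `G` in the preferred chart at `1`. -/
def chartMul (p : 𝔼 × 𝔼) : 𝔼 :=
  extChartAt (𝓡 d) (1 : G)
    ((extChartAt (𝓡 d) (1 : G)).symm p.1 * (extChartAt (𝓡 d) (1 : G)).symm p.2)

variable [LieGroup (𝓡 d) ∞ G]

variable (d G) in
lemma LieGroup.isManifold_top : IsManifold (𝓡 d) ∞ G := LieGroup.toContMDiffMul.toIsManifold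

lemma contMDiffAt_extChartAt_symm_chartOne :
    ContMDiffAt 𝓘(ℝ, 𝔼) (𝓡 d) ∞ (extChartAt (𝓡 d) (1 : G)).symm (chartOne d G) := by
  have := LieGroup.isManifold_top d G
  exact (contMDiffOn_extChartAt_symm (I := 𝓡 d) (1 : G)).contMDiffAt eventually_chart_target

lemma contDiffAt_chartMul : ContDiffAt ℝ ∞ (chartMul d G) (chartOne d G, chartOne d G) := by
  have := LieGroup.isManifold_top d G
  have h1 : ContMDiffAt (𝓘(ℝ, 𝔼).prod 𝓘(ℝ, 𝔼)) (𝓡 d) ∞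
      (fun p : 𝔼 × 𝔼 => (extChartAt (𝓡 d) (1 : G)).symm p.1 * (extChartAt (𝓡 d) (1 : G)).symm p.2)
      (chartOne d G, chartOne d G) :=
    (contMDiffAt_extChartAt_symm_chartOne.comp (x := (chartOne d G, chartOne d G))
      contMDiffAt_fst).mul
      (contMDiffAt_extChartAt_symm_chartOne.comp (x := (chartOne d G, chartOne d G))
      contMDiffAt_snd)
  have h2 : ContMDiffAt (𝓡 d) 𝓘(ℝ, 𝔼) ∞ (extChartAt (𝓡 d) (1 : G))
      ((extChartAt (𝓡 d) (1 : G)).symm (chartOne d G) *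
        (extChartAt (𝓡 d) (1 : G)).symm (chartOne d G)) := by
    rw [extChartAt_symm_chartOne, mul_one]
    exact contMDiffAt_extChartAt
  have h3 : ContMDiffAt (𝓘(ℝ, 𝔼).prod 𝓘(ℝ, 𝔼)) 𝓘(ℝ, 𝔼) ∞ (chartMul d G)
      (chartOne d G, chartOne d G) := ContMDiffAt.comp (chartOne d G, chartOne d G) h2 h1
  rw [← contMDiffAt_iff_contDiffAt, modelWithCornersSelf_prod, ← chartedSpaceSelf_prod]
  exact h3

/-- The derivative of the preferred chart at `1`. -/
def chartDeriv (g : G) : 𝔼 →L[ℝ] 𝔼 := mfderiv (𝓡 d) 𝓘(ℝ, 𝔼) (extChartAt (𝓡 d) (1 : G)) g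

lemma fderiv_chart_comp {F : G → G} (hF : MDifferentiableAt (𝓡 d) (𝓡 d) F 1)
    (h : F 1 ∈ (extChartAt (𝓡 d) (1 : G)).source) :
    fderiv ℝ (fun x => extChartAt (𝓡 d) (1 : G) (F ((extChartAt (𝓡 d) (1 : G)).symm x)))
      (chartOne d G) = (chartDeriv (d := d) (F 1)).comp (modelDeriv F 1) := by
  have := LieGroup.isManifold_one d G
  have hφ : MDifferentiableAt (𝓡 d) 𝓘(ℝ, 𝔼) (extChartAt (𝓡 d) (1 : G)) (F 1) :=
    mdifferentiableAt_extChartAt (by simpa using h)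
  have h2 : HasFDerivWithinAt
      (fun x => extChartAt (𝓡 d) (1 : G) (F ((extChartAt (𝓡 d) (1 : G)).symm x)))
      ((chartDeriv (d := d) (F 1)).comp (modelDeriv F 1)) (range (𝓡 d)) (chartOne d G) :=
    (HasMFDerivAt.comp 1 hφ.hasMFDerivAt hF.hasMFDerivAt).2
  exact (h2.hasFDerivAt (by simp)).fderiv

lemma chartDeriv_one : chartDeriv (d := d) (1 : G) = .id ℝ _ := by
  have := LieGroup.isManifold_one d G
  exact mfderiv_extChartAt_self

/-- The left-invariant fields in the preferred chart at `1`. -/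
lemma fderiv_chartMul_inr {x : 𝔼} (hx : x ∈ (extChartAt (𝓡 d) (1 : G)).target)
    (hm : DifferentiableAt ℝ (chartMul d G) (x, chartOne d G)) :
    (fderiv ℝ (chartMul d G) (x, chartOne d G)).comp (.inr ℝ 𝔼 𝔼) =
      (chartDeriv (d := d) ((extChartAt (𝓡 d) (1 : G)).symm x)).comp
        (modelDeriv (fun y : G => (extChartAt (𝓡 d) (1 : G)).symm x * y) 1) := by
  have h := fderiv_chart_comp (d := d) (G := G)
    (F := fun y : G => (extChartAt (𝓡 d) (1 : G)).symm x * y) (mdiff_mul_left _ _)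
    (by simpa using (extChartAt (𝓡 d) (1 : G)).map_target hx)
  rw [mul_one] at h
  rw [← h]
  exact (HasFDerivAt.comp (chartOne d G) (f := fun y : 𝔼 => (x, y)) hm.hasFDerivAt
      (hasFDerivAt_prodMk_right x (chartOne d G))).fderiv.symm

lemma fderiv_chartMul_inl {x : 𝔼} (hx : x ∈ (extChartAt (𝓡 d) (1 : G)).target)
    (hm : DifferentiableAt ℝ (chartMul d G) (chartOne d G, x)) :
    (fderiv ℝ (chartMul d G) (chartOne d G, x)).comp (.inl ℝ 𝔼 𝔼) =
      (chartDeriv (d := d) ((extChartAt (𝓡 d) (1 : G)).symm x)).comp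
        (modelDeriv (fun y : G => y * (extChartAt (𝓡 d) (1 : G)).symm x) 1) := by
  have h := fderiv_chart_comp (d := d) (G := G)
    (F := fun y : G => y * (extChartAt (𝓡 d) (1 : G)).symm x) (mdiff_mul_right _ _)
    (by simpa using (extChartAt (𝓡 d) (1 : G)).map_target hx)
  rw [one_mul] at h
  rw [← h]
  exact (HasFDerivAt.comp (chartOne d G) (f := fun y : 𝔼 => (y, x)) hm.hasFDerivAt
      (hasFDerivAt_prodMk_left (chartOne d G) x)).fderiv.symm

/-- From `g y = (g y g⁻¹) g`. In the chart this is the relation between the two partial derivatives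
of the multiplication that `exists_hasFDerivAt_of_partial_fderiv` requires. -/
lemma modelDeriv_mul_left_eq_mul_right_comp_Ad (g : G) :
    modelDeriv (d := d) (fun y : G => g * y) 1 =
      (modelDeriv (fun y : G => y * g) 1).comp (Ad d g : 𝔼 →L[ℝ] 𝔼) := by
  have h := modelDeriv_comp (d := d) (F := fun y : G => y * g) (H := MulAut.conj g) (x := 1)
    (mdiff_mul_right _ _) (mdiff_conj g _)
  have e : (fun y : G => y * g) ∘ (MulAut.conj g) = fun y => g * y := by ext y; simp
  rw [e, map_one] at h
  exact h

lemma eventually_differentiableAt_chartMul :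
    ∀ᶠ p in 𝓝 (chartOne d G, chartOne d G), DifferentiableAt ℝ (chartMul d G) p := by
  filter_upwards [(contDiffAt_chartMul.of_le (m := 1) (by simp)).eventually (by simp)] with p hp
  exact hp.differentiableAt (by simp)

/-- In the chart, the left-invariant field of `Z` is the partial derivative of the multiplication in
its second variable at the unit, applied to `Z`; the rest is the formula for the bracket of vector
fields on a vector space. -/
lemma bracket_eq_fderiv_chartMul (X Y : 𝔤) : (⁅X, Y⁆ : 𝔤) =
    fderiv ℝ (fun x => fderiv ℝ (chartMul d G) (x, chartOne d G) (0, Y)) (chartOne d G) X -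
      fderiv ℝ (fun x => fderiv ℝ (chartMul d G) (x, chartOne d G) (0, X)) (chartOne d G) Y := by
  have := LieGroup.isManifold_one d G
  have hev1 : ∀ᶠ x in 𝓝 (chartOne d G), DifferentiableAt ℝ (chartMul d G) (x, chartOne d G) :=
    (Continuous.prodMk_left (chartOne d G)).continuousAt.eventually
      eventually_differentiableAt_chartMul
  let W (Z : 𝔤) : 𝔼 → 𝔼 := VectorField.mpullbackWithin 𝓘(ℝ, 𝔼) (𝓡 d)
    (extChartAt (𝓡 d) (1 : G)).symm (mulInvariantVectorField Z) (range (𝓡 d))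
  have hW (Z : 𝔤) : W Z =ᶠ[𝓝 (chartOne d G)]
      fun x => fderiv ℝ (chartMul d G) (x, chartOne d G) (0, Z) := by
    filter_upwards [hev1, eventually_chart_target (d := d) (G := G)] with x h1 hx
    have e1 := congrArg (fun L : 𝔼 →L[ℝ] 𝔼 => L Z) (fderiv_chartMul_inr hx h1)
    have e2 : (mfderivWithin 𝓘(ℝ, 𝔼) (𝓡 d) (extChartAt (𝓡 d) (1 : G)).symm (range (𝓡 d)) x).inverse
        = chartDeriv (d := d) ((extChartAt (𝓡 d) (1 : G)).symm x) :=
      ContinuousLinearMap.inverse_eq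
        (mfderivWithin_extChartAt_symm_comp_mfderiv_extChartAt hx)
        (mfderiv_extChartAt_comp_mfderivWithin_extChartAt_symm hx)
    refine Eq.trans ?_ e1.symm
    exact congrArg (fun L : 𝔼 →L[ℝ] 𝔼 => L (modelDeriv (d := d)
      (fun y : G => (extChartAt (𝓡 d) (1 : G)).symm x * y) 1 Z)) e2
  have hW0 (Z : 𝔤) : W Z (chartOne d G) = Z := by
    rw [(hW Z).self_of_nhds]
    have e1 := congrArg (fun L : 𝔼 →L[ℝ] 𝔼 => L Z)
      (fderiv_chartMul_inr eventually_chart_target.self_of_nhds hev1.self_of_nhds)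
    rw [extChartAt_symm_chartOne, chartDeriv_one] at e1
    simp only [one_mul] at e1
    exact e1.trans (congrArg (fun L : 𝔼 →L[ℝ] 𝔼 => L Z) (modelDeriv_id (d := d) (1 : G)))
  have hbr : (⁅X, Y⁆ : 𝔤) = (chartDeriv (d := d) (1 : G)).inverse
      (VectorField.lieBracketWithin ℝ (W X) (W Y)
        ((extChartAt (𝓡 d) (1 : G)).symm ⁻¹' univ ∩ range (𝓡 d)) (chartOne d G)) := rfl
  rw [hbr, chartDeriv_one, ContinuousLinearMap.inverse_id, preimage_univ, univ_inter,
    (𝓡 d).range_eq_univ, VectorField.lieBracketWithin_univ, VectorField.lieBracket_eq]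
  simp only [hW0]
  rw [(hW X).fderiv_eq, (hW Y).fderiv_eq]
  rfl

/-- The differential of the adjoint representation is the bracket. -/
lemma exists_hasFDerivAt_Ad_chart :
    ∃ A' : 𝔼 →L[ℝ] 𝔼 →L[ℝ] 𝔼,
      HasFDerivAt (fun x : 𝔼 => (Ad d ((extChartAt (𝓡 d) (1 : G)).symm x) : 𝔼 →L[ℝ] 𝔼)) A'
        (chartOne d G) ∧ ∀ X Y : 𝔤, A' X Y = (⁅X, Y⁆ : 𝔤) := by
  have hev1 : ∀ᶠ x in 𝓝 (chartOne d G), DifferentiableAt ℝ (chartMul d G) (x, chartOne d G) :=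
    (Continuous.prodMk_left (chartOne d G)).continuousAt.eventually
      eventually_differentiableAt_chartMul
  have hev2 : ∀ᶠ x in 𝓝 (chartOne d G), DifferentiableAt ℝ (chartMul d G) (chartOne d G, x) :=
    (Continuous.prodMk_right (chartOne d G)).continuousAt.eventually
      eventually_differentiableAt_chartMul
  have h1 : (fderiv ℝ (chartMul d G) (chartOne d G, chartOne d G)).comp (.inl ℝ 𝔼 𝔼) =
      .id ℝ 𝔼 := by
    rw [fderiv_chartMul_inl eventually_chart_target.self_of_nhds hev1.self_of_nhds,
      extChartAt_symm_chartOne, chartDeriv_one]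
    simp only [mul_one]
    exact modelDeriv_id (d := d) (1 : G)
  have h2 : (fderiv ℝ (chartMul d G) (chartOne d G, chartOne d G)).comp (.inr ℝ 𝔼 𝔼) =
      .id ℝ 𝔼 := by
    rw [fderiv_chartMul_inr eventually_chart_target.self_of_nhds hev1.self_of_nhds,
      extChartAt_symm_chartOne, chartDeriv_one]
    simp only [one_mul]
    exact modelDeriv_id (d := d) (1 : G)
  obtain ⟨A', hA', h⟩ := exists_hasFDerivAt_of_partial_fderiv (m := chartMul d G)
    (a := chartOne d G)
    (A := fun x : 𝔼 => (Ad d ((extChartAt (𝓡 d) (1 : G)).symm x) : 𝔼 →L[ℝ] 𝔼))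
    (contDiffAt_chartMul.of_le (by norm_cast)) h1 h2 (by
      filter_upwards [hev1, hev2, eventually_chart_target (d := d) (G := G)] with x h1 h2 hx
      rw [fderiv_chartMul_inl hx h2, fderiv_chartMul_inr hx h1,
        modelDeriv_mul_left_eq_mul_right_comp_Ad]
      rfl)
  exact ⟨A', hA', fun X Y => (h X Y).trans (bracket_eq_fderiv_chartMul X Y).symm⟩

end AdjointDerivative

/-! ### One-parameter groups in Banach algebras. -/

section OneParameterGroups

open Set Filter Topology

/-- A differentiable one-parameter group in a Banach algebra is given by the exponential. -/
lemma eq_exp_smul_of_hasDerivAt_zero {𝔸 : Type*} [NormedRing 𝔸] [NormedAlgebra ℝ 𝔸]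
    [CompleteSpace 𝔸] {c : ℝ → 𝔸} {A : 𝔸} (h0 : c 0 = 1) (hadd : ∀ s t, c (s + t) = c s * c t)
    (hA : HasDerivAt c A 0) (t : ℝ) : c t = NormedSpace.exp (t • A) := by
  have hd (t : ℝ) : HasDerivAt (fun s => c (-s)) (-(c (-t) * A)) t := by
    have h1 : HasDerivAt (fun s => c (t - s)) (-A) t := by
      have h2 : HasDerivAt (fun s : ℝ => t - s) (-1) t := (hasDerivAt_id t).const_sub t
      have h3 := HasDerivAt.scomp (g₁ := c) (g₁' := A) t (by simpa using hA) h2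
      rw [neg_smul, one_smul] at h3
      exact h3
    refine ((h1.const_mul (c (-t))).congr_of_eventuallyEq
      (Eventually.of_forall fun s => ?_)).congr_deriv (by simp)
    simp only
    rw [← hadd]
    congr 1
    ring
  have hc (t : ℝ) : HasDerivAt (fun s => c (-s) * NormedSpace.exp (s • A)) 0 t := by
    refine ((hd t).mul (hasDerivAt_exp_smul_const' A t)).congr_deriv ?_
    rw [neg_mul, mul_assoc, neg_add_cancel]
  have hconst := is_const_of_deriv_eq_zero (fun t => (hc t).differentiableAt)
    (fun t => (hc t).deriv) t 0
  simp only [neg_zero, h0, zero_smul, NormedSpace.exp_zero, mul_one] at hconst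
  have h1 : c t * c (-t) = 1 := by rw [← hadd, add_neg_cancel, h0]
  rw [← mul_one (c t), ← hconst, ← mul_assoc, h1, one_mul]

end OneParameterGroups

/-! ### `Ad` along exponential curves, and its kernel. -/

noncomputable section AdjointExponential

open Set Filter Topology

variable {d : ℕ} {G : Type*} [TopologicalSpace G] [ChartedSpace (EuclideanSpace ℝ (Fin d)) G]
  [Group G]

local notation "𝔤" => GroupLieAlgebra (𝓡 d) G
local notation "𝔼" => EuclideanSpace ℝ (Fin d)

/-- The adjoint representation with values in the endomorphisms of the model space. -/
def modelAd (g : G) : 𝔼 →L[ℝ] 𝔼 := Ad d g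

lemma modelAd_one : modelAd (d := d) (1 : G) = 1 :=
  ContinuousLinearMap.ext fun X => Ad_one_apply (G := G) X

lemma eventually_chart_source_one :
    ∀ᶠ g in 𝓝 (1 : G), (extChartAt (𝓡 d) (1 : G)).symm (extChartAt (𝓡 d) (1 : G) g) = g := by
  filter_upwards [extChartAt_source_mem_nhds (I := 𝓡 d) (1 : G)] with g hg
  exact (extChartAt (𝓡 d) (1 : G)).left_inv hg

variable [LieGroup (𝓡 d) ∞ G]

variable (d G) in
/-- The Lie bracket as a continuous bilinear map on the model space. -/
def bracketL : 𝔼 →L[ℝ] 𝔼 →L[ℝ] 𝔼 := (exists_hasFDerivAt_Ad_chart (d := d) (G := G)).choose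

lemma bracketL_apply (X Y : 𝔤) : bracketL d G X Y = (⁅X, Y⁆ : 𝔤) :=
  (exists_hasFDerivAt_Ad_chart (d := d) (G := G)).choose_spec.2 X Y

lemma hasFDerivAt_modelAd_chart :
    HasFDerivAt (fun x : 𝔼 => modelAd (d := d) ((extChartAt (𝓡 d) (1 : G)).symm x)) (bracketL d G)
      (chartOne d G) :=
  (exists_hasFDerivAt_Ad_chart (d := d) (G := G)).choose_spec.1

lemma modelAd_mul (g g' : G) : modelAd (d := d) (g * g') = modelAd g * modelAd g' :=
  ContinuousLinearMap.ext fun X => Ad_mul_apply g g' X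

/-- Differentiability in the chart gives continuity at `1`, and multiplicativity carries it to every
point. -/
lemma continuous_modelAd [IsTopologicalGroup G] : Continuous (modelAd (d := d) : G → 𝔼 →L[ℝ] 𝔼) := by
  have h1 : ContinuousAt (modelAd (d := d) : G → 𝔼 →L[ℝ] 𝔼) 1 := by
    have h := ContinuousAt.comp (f := extChartAt (𝓡 d) (1 : G)) (x := 1)
      hasFDerivAt_modelAd_chart.continuousAt (continuousAt_extChartAt (I := 𝓡 d) (1 : G))
    refine h.congr ?_
    filter_upwards [eventually_chart_source_one (d := d) (G := G)] with g hg
    exact congrArg modelAd hg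
  refine continuous_iff_continuousAt.2 fun g => ?_
  have e : (modelAd (d := d) : G → 𝔼 →L[ℝ] 𝔼) = fun x => modelAd g * modelAd (g⁻¹ * x) := by
    funext x; rw [← modelAd_mul, mul_inv_cancel_left]
  rw [e]
  refine continuousAt_const.mul (ContinuousAt.comp (f := fun x => g⁻¹ * x) ?_
    (continuous_const_mul g⁻¹).continuousAt)
  rwa [inv_mul_cancel]

lemma HasVelocity.hasDerivAt_modelAd {γ : ℝ → G} {v : 𝔼} {t : ℝ} (hγ : HasVelocity γ v t)
    (h1 : γ t = 1) : HasDerivAt (fun s => modelAd (d := d) (γ s)) (bracketL d G v) t := by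
  have := LieGroup.isManifold_one d G
  have h2 : HasFDerivWithinAt (fun s => extChartAt (𝓡 d) (γ t) (γ s))
      ((1 : ℝ →L[ℝ] ℝ).smulRight v) (range 𝓘(ℝ, ℝ)) t := hγ.2
  rw [h1] at h2
  have h4 : HasDerivAt (extChartAt (𝓡 d) (1 : G) ∘ γ) v t := by
    refine (h2.hasFDerivAt (by simp)).hasDerivAt.congr_deriv ?_
    simp
  have h5 : HasDerivAt (fun s => modelAd (d := d)
      ((extChartAt (𝓡 d) (1 : G)).symm (extChartAt (𝓡 d) (1 : G) (γ s)))) (bracketL d G v) t := by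
    refine HasFDerivAt.comp_hasDerivAt
      (l := fun x : 𝔼 => modelAd (d := d) ((extChartAt (𝓡 d) (1 : G)).symm x))
      (f := extChartAt (𝓡 d) (1 : G) ∘ γ) t ?_ h4
    have : (extChartAt (𝓡 d) (1 : G) ∘ γ) t = chartOne d G := by simp [h1, chartOne]
    rw [this]
    exact hasFDerivAt_modelAd_chart
  refine h5.congr_of_eventuallyEq ?_
  have hc : Tendsto γ (𝓝 t) (𝓝 1) := by
    have := hγ.continuousAt
    rwa [ContinuousAt, h1] at this
  filter_upwards [hc.eventually (eventually_chart_source_one (d := d) (G := G))] with s hs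
  rw [hs]

lemma IsExpCurve.modelAd_eq [T2Space G] {X : 𝔤} {γ : ℝ → G} (h : IsExpCurve X γ) (t : ℝ) :
    modelAd (d := d) (γ t) = NormedSpace.exp (t • bracketL d G X) :=
  eq_exp_smul_of_hasDerivAt_zero (by rw [h.1, modelAd_one])
    (fun s t => by rw [h.map_add, modelAd_mul]) (h.hasVelocity_zero.hasDerivAt_modelAd h.1) t

/-- The derivative of `t ↦ Ad (exp (t X)) Y`. -/
lemma IsExpCurve.hasDerivAt_Ad [T2Space G] {X : 𝔤} {γ : ℝ → G} (h : IsExpCurve X γ) (Y : 𝔤)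
    (t : ℝ) : HasDerivAt (F := 𝔼) (fun s => Ad d (γ s) Y) (Ad d (γ t) ⁅X, Y⁆) t := by
  have key (A : 𝔼 →L[ℝ] 𝔼) (y : 𝔼) : HasDerivAt (fun s : ℝ => NormedSpace.exp (s • A) y)
      (NormedSpace.exp (t • A) (A y)) t := by
    simpa using (hasDerivAt_exp_smul_const A t).clm_apply (hasDerivAt_const t y)
  refine ((key (bracketL d G X) Y).congr_of_eventuallyEq
    (Eventually.of_forall fun s => ?_)).congr_deriv ?_
  · exact congrArg (fun L : 𝔼 →L[ℝ] 𝔼 => L Y) (h.modelAd_eq s)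
  · rw [← h.modelAd_eq]
    exact congrArg (modelAd (d := d) (γ t)) (bracketL_apply X Y)

/-- Conjugation maps exponential curves to exponential curves. -/
lemma IsExpCurve.conj [T2Space G] {X : 𝔤} {γ : ℝ → G} (h : IsExpCurve X γ) (g : G) :
    IsExpCurve (Ad d g X) (fun t => g * γ t * g⁻¹) :=
  h.map _ (mdiff_conj g)

lemma IsExpCurve.Ad_eq_self [T2Space G] {X : 𝔤} {γ : ℝ → G} (h : IsExpCurve X γ) {g : G}
    (hg : ∀ t, Commute g (γ t)) : Ad d g X = X := by
  have e : (fun t => g * γ t * g⁻¹) = γ := by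
    funext t; rw [(hg t).eq, mul_inv_cancel_right]
  have h1 := (h.conj g).hasVelocity_zero
  rw [e] at h1
  exact h1.unique h.hasVelocity_zero

lemma IsExpCurve.commute [T2Space G] {X : 𝔤} {γ : ℝ → G} (h : IsExpCurve X γ) {g : G}
    (hg : Ad d g X = X) (t : ℝ) : Commute g (γ t) := by
  have h1 := h.conj g
  rw [hg] at h1
  have := congrFun (h1.unique h) t
  exact mul_inv_eq_iff_eq_mul.1 this

/-- `exp X` fixes every vector commuting with `X`. -/
lemma IsExpCurve.Ad_eq_of_lie_eq_zero [T2Space G] {X Y : 𝔤} {γ : ℝ → G} (h : IsExpCurve X γ)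
    (hXY : ⁅X, Y⁆ = 0) (t : ℝ) : Ad d (γ t) Y = Y := by
  have hd (t : ℝ) : HasDerivAt (F := 𝔼) (fun s => Ad d (γ s) Y) 0 t := by
    refine (h.hasDerivAt_Ad Y t).congr_deriv ?_
    rw [hXY]
    exact (modelAd (d := d) (γ t)).map_zero
  have hconst := is_const_of_deriv_eq_zero (fun t => (hd t).differentiableAt)
    (fun t => (hd t).deriv) t 0
  exact hconst.trans (by rw [h.1]; exact Ad_one_apply Y)

/-- The curve `s ↦ Ad (γ s) Y` is constant, and its derivative at `0` is the bracket. -/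
lemma lie_eq_zero_of_commute [T2Space G] {X Y : 𝔤} {γ γ' : ℝ → G} (h : IsExpCurve X γ)
    (h' : IsExpCurve Y γ') (hc : ∀ s t, Commute (γ s) (γ' t)) : ⁅X, Y⁆ = 0 := by
  have hd := h.hasDerivAt_Ad Y 0
  have e : (fun s => (Ad d (γ s) Y : 𝔼)) = fun _ => Y := by
    funext s
    exact h'.Ad_eq_self (hc s)
  rw [e] at hd
  have := hd.unique (hasDerivAt_const (F := 𝔼) 0 Y)
  rw [h.1] at this
  exact (Ad_one_apply (G := G) ⁅X, Y⁆).symm.trans this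

lemma modelDeriv_mul_left_surjective (g : G) :
    Function.Surjective (modelDeriv (d := d) (fun y : G => g * y) 1) := by
  intro v
  have h := modelDeriv_comp (d := d) (F := fun y : G => g * y) (H := fun y : G => g⁻¹ * y) (x := g)
    (mdiff_mul_left _ _) (mdiff_mul_left _ _)
  have e : (fun y : G => g * y) ∘ (fun y : G => g⁻¹ * y) = id := by ext; simp
  rw [e, modelDeriv_id, inv_mul_cancel] at h
  exact ⟨modelDeriv (d := d) (fun y : G => g⁻¹ * y) g v,
    (congrArg (fun L : 𝔼 →L[ℝ] 𝔼 => L v) h).symm⟩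

/-- A map with vanishing derivative is locally constant at `1`. -/
lemma eventually_eq_of_modelDeriv_eq_zero {F : G → G} (hF : MDifferentiable (𝓡 d) (𝓡 d) F)
    (h0 : ∀ x, modelDeriv (d := d) F x = 0) (h1 : F 1 = 1) : ∀ᶠ g in 𝓝 (1 : G), F g = 1 := by
  have := LieGroup.isManifold_one d G
  have hsymm : ContinuousAt (extChartAt (𝓡 d) (1 : G)).symm (chartOne d G) :=
    contMDiffAt_extChartAt_symm_chartOne.continuousAt
  have hFs : ∀ᶠ x in 𝓝 (chartOne d G), F ((extChartAt (𝓡 d) (1 : G)).symm x) ∈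
      (extChartAt (𝓡 d) (1 : G)).source := by
    have hc : ContinuousAt (F ∘ (extChartAt (𝓡 d) (1 : G)).symm) (chartOne d G) :=
      ContinuousAt.comp hF.continuous.continuousAt hsymm
    refine hc.eventually_mem ?_
    rw [Function.comp, extChartAt_symm_chartOne, h1]
    exact extChartAt_source_mem_nhds (I := 𝓡 d) (1 : G)
  obtain ⟨ε, hε, hball⟩ := Metric.eventually_nhds_iff_ball.1
    (hFs.and (eventually_chart_target (d := d) (G := G)))
  let f : 𝔼 → 𝔼 := fun x => extChartAt (𝓡 d) (1 : G) (F ((extChartAt (𝓡 d) (1 : G)).symm x))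
  have hf (x : 𝔼) (hx : x ∈ Metric.ball (chartOne d G) ε) : HasFDerivAt f (0 : 𝔼 →L[ℝ] 𝔼) x := by
    obtain ⟨hs, ht⟩ := hball x hx
    have hφ : MDifferentiableAt (𝓡 d) 𝓘(ℝ, 𝔼) (extChartAt (𝓡 d) (1 : G))
        (F ((extChartAt (𝓡 d) (1 : G)).symm x)) := mdifferentiableAt_extChartAt (by simpa using hs)
    have hψ : MDifferentiableAt 𝓘(ℝ, 𝔼) (𝓡 d) (extChartAt (𝓡 d) (1 : G)).symm x :=
      ((contMDiffOn_extChartAt_symm (I := 𝓡 d) (n := 1) (1 : G)).contMDiffAt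
        (extChartAt_target_mem_nhds' ht)).mdifferentiableAt (by simp)
    have hFd : HasMFDerivAt (𝓡 d) (𝓡 d) F ((extChartAt (𝓡 d) (1 : G)).symm x)
        (0 : 𝔼 →L[ℝ] 𝔼) := by
      rw [← h0 ((extChartAt (𝓡 d) (1 : G)).symm x)]
      exact (hF _).hasMFDerivAt
    have hc := HasMFDerivAt.comp x (hφ.hasMFDerivAt) (HasMFDerivAt.comp x hFd hψ.hasMFDerivAt)
    have hc' : HasMFDerivAt 𝓘(ℝ, 𝔼) 𝓘(ℝ, 𝔼) f x (0 : 𝔼 →L[ℝ] 𝔼) := by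
      have e (A B : 𝔼 →L[ℝ] 𝔼) : (0 : 𝔼 →L[ℝ] 𝔼) = A.comp ((0 : 𝔼 →L[ℝ] 𝔼).comp B) := by simp
      rw [e (chartDeriv (d := d) (F ((extChartAt (𝓡 d) (1 : G)).symm x)))
        (mfderiv 𝓘(ℝ, 𝔼) (𝓡 d) (extChartAt (𝓡 d) (1 : G)).symm x)]
      exact hc
    exact hasMFDerivAt_iff_hasFDerivAt.1 hc'
  have hconst (x : 𝔼) (hx : x ∈ Metric.ball (chartOne d G) ε) : f x = f (chartOne d G) :=
    (convex_ball _ _).is_const_of_fderivWithin_eq_zero (𝕜 := ℝ)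
      (fun y hy => (hf y hy).differentiableAt.differentiableWithinAt)
      (fun y hy => by
        rw [fderivWithin_of_isOpen Metric.isOpen_ball hy, (hf y hy).fderiv]) hx
      (Metric.mem_ball_self hε)
  have hball1 : ∀ᶠ g in 𝓝 (1 : G), extChartAt (𝓡 d) (1 : G) g ∈ Metric.ball (chartOne d G) ε :=
    (continuousAt_extChartAt (I := 𝓡 d) (1 : G)).eventually_mem (Metric.ball_mem_nhds _ hε)
  filter_upwards [hball1, eventually_chart_source_one (d := d) (G := G)] with g hg hg'
  have h2 := hconst _ hg
  simp only [f, hg', extChartAt_symm_chartOne, h1] at h2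
  refine (extChartAt (𝓡 d) (1 : G)).injOn ?_ (mem_extChartAt_source 1) h2
  rw [← hg']
  exact (hball _ hg).1

/-- In a connected Lie group, the kernel of the adjoint representation is central. -/
lemma mem_center_of_Ad_eq_id [T2Space G] [ConnectedSpace G] {z : G} (hz : ∀ X : 𝔤, Ad d z X = X) :
    z ∈ Subgroup.center G := by
  have := topologicalGroup_of_lieGroup (I := 𝓡 d) (n := ∞) (G := G)
  let c : G →* G := (MulAut.conj z).toMonoidHom
  have hc : MDifferentiable (𝓡 d) (𝓡 d) c := mdiff_conj z
  -- The commutator `F` with `z` has zero derivative at `1`, because `c = F · id` and `dc = Ad z =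
  -- id` there. By `F (g y) = c g F(y) g⁻¹` the derivative vanishes everywhere, so `F = 1` near `1`:
  -- the centralizer of `z` is open, hence all of the connected group.
  let F : G → G := fun x => c x * x⁻¹
  have hF : MDifferentiable (𝓡 d) (𝓡 d) F :=
    ((contMDiff_conj z).mul (contMDiff_inv (𝓡 d) ∞)).mdifferentiable (by simp)
  have hF1 : F 1 = 1 := by simp [F]
  have h1 : modelDeriv (d := d) F 1 = 0 := by
    ext1 v
    obtain ⟨γ, hγ⟩ := exists_isExpCurve (d := d) (G := G) v
    have hv : HasVelocity γ v 0 := hγ.hasVelocity_zero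
    have a1 := hasVelocity_mul (hv.comp (hF _)) hv (by simp [hγ.1, hF1]) hγ.1
    have a2 := hv.comp (hc _)
    have e : (fun t => (F ∘ γ) t * γ t) = c ∘ γ := by funext t; simp [F]
    rw [e] at a1
    have a3 := a1.unique a2
    rw [hγ.1] at a3
    have a4 : modelDeriv (d := d) c 1 v = v := hz v
    rw [a4] at a3
    simpa using a3
  have h0 (g : G) : modelDeriv (d := d) F g = 0 := by
    ext1 v
    obtain ⟨w, rfl⟩ := modelDeriv_mul_left_surjective (d := d) g v
    have a1 := modelDeriv_comp (d := d) (F := F) (H := fun y : G => g * y) (x := 1) (hF _)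
      (mdiff_mul_left _ _)
    have hr : MDifferentiable (𝓡 d) (𝓡 d) (fun y : G => c g * (y * g⁻¹)) := fun x =>
      (mdiff_mul_left (c g) (x * g⁻¹)).comp x (mdiff_mul_right g⁻¹ x)
    have a2 := modelDeriv_comp (d := d) (F := fun y : G => c g * (y * g⁻¹)) (H := F) (x := 1)
      (hr _) (hF _)
    have e : F ∘ (fun y : G => g * y) = (fun y : G => c g * (y * g⁻¹)) ∘ F := by
      ext y; simp [F, mul_assoc]
    rw [e, a2, h1, mul_one] at a1
    simpa using (congrArg (fun L : 𝔼 →L[ℝ] 𝔼 => L w) a1).symm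
  have hev := eventually_eq_of_modelDeriv_eq_zero hF h0 hF1
  let C : Subgroup G := Subgroup.centralizer {z}
  have hC : (C : Set G) ∈ 𝓝 1 := by
    filter_upwards [hev] with g hg
    rw [SetLike.mem_coe, Subgroup.mem_centralizer_singleton_iff]
    have : z * g * z⁻¹ = g := mul_inv_eq_one.1 hg
    exact (mul_inv_eq_iff_eq_mul.1 this).symm
  have hopen : IsOpen (C : Set G) := C.isOpen_of_mem_nhds hC
  have huniv : (C : Set G) = univ :=
    IsClopen.eq_univ ⟨C.isClosed_of_isOpen hopen, hopen⟩ ⟨1, C.one_mem⟩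
  rw [Subgroup.mem_center_iff]
  intro g
  have hg : g ∈ (C : Set G) := huniv ▸ mem_univ g
  exact Subgroup.mem_centralizer_singleton_iff.1 hg

end AdjointExponential

/-! ### Characters of real vector spaces and neighborhoods of the trivial character. -/

section CircleCharacters

open Set Filter Topology

lemma Circle.eq_of_forall_exp_mul_eq {a b : ℝ} (h : ∀ s : ℝ, Circle.exp (a * s) = Circle.exp (b * s)) :
    a = b := by
  by_contra hne
  -- At this time the two angles differ by exactly `π`, which is not a multiple of `2π`.
  have h1 := h (Real.pi / (a - b))
  rw [Circle.exp_eq_exp] at h1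
  obtain ⟨m, hm⟩ := h1
  have hab : a - b ≠ 0 := sub_ne_zero.2 hne
  have h2 : Real.pi = m * (2 * Real.pi) := by
    have : a * (Real.pi / (a - b)) - b * (Real.pi / (a - b)) = Real.pi := by
      field_simp
    linarith
  have h3 : (1 : ℝ) = m * 2 := by
    have := Real.pi_pos
    have h4 : Real.pi * 1 = Real.pi * (m * 2) := by linarith
    exact mul_left_cancel₀ this.ne' h4
  have h4 : (1 : ℤ) = m * 2 := by exact_mod_cast h3
  omega

lemma Circle.abs_lt_of_forall_exp_mem_centeredArc {a ε : ℝ} (hε : 0 < ε) (hε' : ε < Real.pi)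
    (h : ∀ s ∈ Icc (0 : ℝ) 1, Circle.exp (a * s) ∈ Circle.centeredArc ε) : |a| < ε := by
  by_contra! hle
  have ha : 0 < |a| := hε.trans_le hle
  have ha0 : a ≠ 0 := abs_pos.1 ha
  -- If `|a| ≥ ε`, the angle reaches absolute value `ε` at this time, leaving the open arc.
  have h1 := h (ε / |a|) ⟨by positivity, (div_le_one ha).2 hle⟩
  rw [Circle.mem_centeredArc hε'.le] at h1
  have h2 : |a * (ε / |a|)| = ε := by
    rw [abs_mul, abs_div, abs_abs, abs_of_pos hε]
    field_simp
  have h3 : a * (ε / |a|) ∈ Ioc (-Real.pi) Real.pi := by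
    have := abs_le.1 h2.le
    exact ⟨by linarith, by linarith⟩
  rw [Circle.arg_exp h3.1 h3.2, h2] at h1
  exact lt_irrefl _ h1

/-- Continuous homomorphisms `ℝ → Circle` are of the form `s ↦ exp (i a s)`. -/
lemma Circle.exists_eq_exp_mul {ρ : ℝ → Circle} (hρ : Continuous ρ)
    (hadd : ∀ s t, ρ (s + t) = ρ s * ρ t) : ∃ a : ℝ, ∀ s, ρ s = Circle.exp (a * s) := by
  have h0 : ρ 0 = 1 := by simpa using hadd 0 0
  have hev : ∀ᶠ s in 𝓝 (0 : ℝ), ρ s ∈ Circle.centeredArc (Real.pi / 2) := by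
    refine hρ.continuousAt.eventually_mem ((Circle.isOpen_centeredArc _).mem_nhds ?_)
    rw [h0, Circle.mem_centeredArc (by linarith [Real.pi_pos])]
    simp [Real.pi_pos]
  obtain ⟨δ, hδ, hball⟩ := Metric.eventually_nhds_iff.1 hev
  simp only [Real.dist_eq, sub_zero] at hball
  have harg (s : ℝ) (hs : |s| < δ) : ∃ x : ℝ, |x| < Real.pi / 2 ∧ Circle.exp x = ρ s := by
    obtain ⟨x, hx, hxs⟩ := (Circle.bijOn_exp_Ioo_centeredArc (r := Real.pi / 2)
      (by linarith [Real.pi_pos])).surjOn (hball hs)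
    exact ⟨x, abs_lt.2 hx, hxs⟩
  obtain ⟨x₀, hx₀, hx₀'⟩ := harg (δ / 2) (by rw [abs_of_pos (by positivity)]; linarith)
  -- Repeated halving: twice a lift of size less than `π / 2` lies in `(-π, π)`, where `Circle.exp`
  -- is injective, so the lift at half the time is half the lift.
  have hdy (k : ℕ) : ρ (δ / 2 / 2 ^ k) = Circle.exp (x₀ / 2 ^ k) := by
    induction k with
    | zero => simpa using hx₀'.symm
    | succ k ih =>
      obtain ⟨x, hx, hxs⟩ := harg (δ / 2 / 2 ^ (k + 1)) (by
        rw [abs_of_pos (by positivity)]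
        calc δ / 2 / 2 ^ (k + 1) ≤ δ / 2 := div_le_self (by positivity) (one_le_pow₀ (by norm_num))
          _ < δ := by linarith)
      have h1 : Circle.exp (x + x) = Circle.exp (x₀ / 2 ^ k) := by
        rw [Circle.exp_add, hxs, ← hadd, ← ih]
        congr 1
        field_simp
        ring
      have h2 : |x₀ / 2 ^ k| < Real.pi / 2 := by
        rw [abs_div, abs_of_pos (by positivity : (0 : ℝ) < 2 ^ k)]
        exact (div_le_self (abs_nonneg _) (one_le_pow₀ (by norm_num))).trans_lt hx₀
      have h3 : x + x = x₀ / 2 ^ k := by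
        rw [abs_lt] at hx h2
        exact Circle.exp_injOn_Ico (a := -Real.pi) (b := Real.pi) (by linarith)
          ⟨by linarith, by linarith⟩ ⟨by linarith, by linarith⟩ h1
      rw [← hxs]
      congr 1
      rw [pow_succ]
      field_simp at h3 ⊢
      linarith
  -- The set of agreement is a closed subgroup, and it is dense because it contains arbitrarily
  -- small positive numbers.
  let S : AddSubgroup ℝ :=
    { carrier := {s | ρ s = Circle.exp (x₀ / (δ / 2) * s)}
      add_mem' := fun {s t} hs ht => by
        simp only [mem_ofPred_eq] at *
        rw [hadd, hs, ht, mul_add, Circle.exp_add]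
      zero_mem' := by simp [h0]
      neg_mem' := fun {s} hs => by
        simp only [mem_ofPred_eq] at *
        have h1 : ρ s * ρ (-s) = 1 := by rw [← hadd, add_neg_cancel, h0]
        rw [mul_neg, Circle.exp_neg, ← hs]
        exact eq_inv_of_mul_eq_one_right h1 }
  have hdense : Dense (S : Set ℝ) := by
    refine AddSubgroup.dense_of_not_isolated_zero S fun ε hε => ?_
    obtain ⟨k, hk⟩ := exists_pow_lt_of_lt_one (show 0 < ε / (δ / 2) by positivity)
      (by norm_num : (1 / 2 : ℝ) < 1)
    refine ⟨δ / 2 / 2 ^ k, ?_, by positivity, ?_⟩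
    · change ρ _ = _
      rw [hdy]
      congr 1
      field_simp
    · rw [lt_div_iff₀ (by positivity)] at hk
      calc δ / 2 / 2 ^ k = (1 / 2) ^ k * (δ / 2) := by rw [one_div, inv_pow]; ring
        _ < ε := hk
  have hclosed : IsClosed (S : Set ℝ) := isClosed_eq hρ (by fun_prop)
  have huniv : (S : Set ℝ) = univ := by rw [← hclosed.closure_eq, hdense.closure_eq]
  exact ⟨x₀ / (δ / 2), fun s => (huniv ▸ mem_univ s : s ∈ (S : Set ℝ))⟩

/-- Characters close to `1` of the image of a vector space are given by small linear forms. -/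
lemma PontryaginDual.setOf_exp_mem_nhds_one {N V W : Type*} [Group N] [TopologicalSpace N]
    [IsTopologicalGroup N] [AddCommGroup V] [Module ℝ V] [Module.Finite ℝ V] [AddCommGroup W]
    [Module ℝ W] [TopologicalSpace W] [IsTopologicalAddGroup W] [ContinuousSMul ℝ W] {ex : V → N}
    (hcont : ∀ X, Continuous fun s : ℝ => ex (s • X)) (hadd : ∀ X Y, ex (X + Y) = ex X * ex Y)
    (B : (V →ₗ[ℝ] ℝ) →ₗ[ℝ] W) {U : Set W} (hU : U ∈ 𝓝 0) :
    {ψ : PontryaginDual N | ∃ l : V →ₗ[ℝ] ℝ, B l ∈ U ∧ ∀ X, ψ (ex X) = Circle.exp (l X)} ∈ 𝓝 1 := by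
  let b := Module.finBasis ℝ V
  let T : (Fin (Module.finrank ℝ V) → ℝ) →ₗ[ℝ] W := B ∘ₗ (b.constr ℝ).toLinearMap
  have hT : Continuous T := T.continuous_on_pi
  have hTU : T ⁻¹' U ∈ 𝓝 0 := hT.continuousAt.preimage_mem_nhds (by simpa using hU)
  obtain ⟨ε', hε', hball⟩ := Metric.mem_nhds_iff.1 hTU
  let ε := min ε' 1
  have hε : 0 < ε := lt_min hε' one_pos
  have hεπ : ε < Real.pi := (min_le_right _ _).trans_lt (by linarith [Real.pi_gt_three])
  have hnhds (i) : {ψ : PontryaginDual N | MapsTo ψ ((fun s : ℝ => ex (s • b i)) '' Icc 0 1)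
      (Circle.centeredArc ε)} ∈ 𝓝 1 := by
    -- A basic compact-open condition on a whole segment: controlling the endpoint alone would bound
    -- the linear form only modulo `2π`.
    refine IsOpen.mem_nhds (isOpen_induced (ContinuousMap.isOpen_setOfPred_mapsTo
      (isCompact_Icc.image (hcont (b i))) (Circle.isOpen_centeredArc ε))) ?_
    intro n _
    rw [PontryaginDual.one_apply, Circle.mem_centeredArc hεπ.le]
    simpa using hε
  filter_upwards [Filter.iInter_mem.2 hnhds] with ψ hψ
  have hm (a b : N) : ψ (a * b) = ψ a * ψ b := _root_.map_mul ψ a b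
  have hex (X : V) : ∃ a : ℝ, ∀ s : ℝ, ψ (ex (s • X)) = Circle.exp (a * s) :=
    Circle.exists_eq_exp_mul (ρ := fun s => ψ (ex (s • X))) ((map_continuous ψ).comp (hcont X))
      (fun s t => by rw [add_smul, hadd, hm])
  choose l hl using hex
  have hl1 (X : V) : ψ (ex X) = Circle.exp (l X) := by simpa using hl X 1
  let l' : V →ₗ[ℝ] ℝ :=
    { toFun := l
      map_add' := fun X Y => Circle.eq_of_forall_exp_mul_eq fun s => by
        rw [← hl, smul_add, hadd, hm, hl, hl, ← Circle.exp_add, add_mul]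
      map_smul' := fun c X => Circle.eq_of_forall_exp_mul_eq fun s => by
        rw [← hl, smul_smul, hl, RingHom.id_apply, smul_eq_mul]
        congr 1
        ring }
  refine ⟨l', ?_, hl1⟩
  have hsmall (i) : |l (b i)| < ε := by
    refine Circle.abs_lt_of_forall_exp_mem_centeredArc hε hεπ fun s hs => ?_
    rw [← hl]
    exact mem_iInter.1 hψ i ⟨s, hs, rfl⟩
  have hmem : (fun i => l (b i)) ∈ Metric.ball (0 : Fin (Module.finrank ℝ V) → ℝ) ε' := by
    rw [mem_ball_zero_iff, pi_norm_lt_iff hε']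
    exact fun i => (hsmall i).trans_le (min_le_left _ _)
  have := hball hmem
  have e : b.constr ℝ (fun i => l (b i)) = l' := b.ext fun i => by simp [l']
  simpa [T, e] using this

end CircleCharacters

/-! ### Structure of the eigenspaces of `ad h`. -/

section TubeTriples

variable {L : Type*} [LieRing L] [LieAlgebra ℝ L]

/-- A `sl₂`-triple adapted to a Cartan involution `θ`, such that `(ad (e - f))²` is `0` on the
compact part and `-4` on the noncompact part. -/
structure IsTubeTriple (θ : L ≃ₗ⁅ℝ⁆ L) (h e f : L) : Prop where
  sl2 : IsSl2Triple h e f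
  involutive : ∀ X, θ (θ X) = X
  pos : ∀ X : L, X ≠ 0 → 0 < -killingForm ℝ L X (θ X)
  f_eq : f = -θ e
  theta_eq : ∀ X, θ X = X + (1 / 2 : ℝ) • ⁅e - f, ⁅e - f, X⁆⁆

variable (h : L) in
/-- The eigenspaces of `ad h`. -/
def adEigenspace (a : ℝ) : Submodule ℝ L := (LieAlgebra.ad ℝ L h).eigenspace a

lemma mem_adEigenspace {h : L} {a : ℝ} {X : L} : X ∈ adEigenspace h a ↔ ⁅h, X⁆ = a • X :=
  Module.End.mem_eigenspace_iff

/-- Serves both for `θ`, with `b = -1`, and for the adjoint action of `M`, with `b = 1`. -/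
lemma map_mem_adEigenspace (A : L ≃ₗ⁅ℝ⁆ L) {h : L} {a b : ℝ} (hA : A h = b • h) {X : L}
    (hX : X ∈ adEigenspace h a) (hb : b * b = 1) : A X ∈ adEigenspace h (b * a) := by
  rw [mem_adEigenspace] at *
  have h1 : A ⁅h, X⁆ = A (a • X) := congrArg A hX
  rw [LieEquiv.map_lie, hA, smul_lie, map_smul] at h1
  have h2 := congrArg (b • ·) h1
  simpa only [smul_smul, hb, one_smul] using h2

section

variable {h e f : L} {θ : L ≃ₗ⁅ℝ⁆ L}

lemma theta_h_of_f_eq (t : IsSl2Triple h e f) (hθ : ∀ X, θ (θ X) = X) (hf : f = -θ e) :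
    θ h = -h := by
  have he : θ e = -f := by rw [hf, neg_neg]
  have hf' : θ f = -e := by rw [hf, map_neg, hθ]
  rw [← t.lie_e_f, LieEquiv.map_lie, he, hf', neg_lie, lie_neg, neg_neg, lie_skew]

lemma lie_sub_lie_sub_h (t : IsSl2Triple h e f) : ⁅e - f, ⁅e - f, h⁆⁆ = -(4 : ℝ) • h := by
  have h1 : ⁅e - f, h⁆ = -(2 : ℝ) • (e + f) := by
    rw [← lie_skew, lie_sub, t.lie_h_e_smul ℝ, t.lie_lie_smul_f ℝ]
    module
  have h2 : ⁅e - f, e + f⁆ = (2 : ℝ) • h := by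
    rw [sub_lie, lie_add, lie_add, lie_self, lie_self, ← lie_skew f e, t.lie_e_f]
    module
  rw [h1, lie_smul, h2, smul_smul]
  norm_num

namespace IsTubeTriple

variable (T : IsTubeTriple θ h e f)
include T

lemma theta_h : θ h = -h := theta_h_of_f_eq T.sl2 T.involutive T.f_eq

lemma theta_mem {a : ℝ} {X : L} (hX : X ∈ adEigenspace h a) : θ X ∈ adEigenspace h (-a) := by
  have := map_mem_adEigenspace θ (b := -1) (by rw [T.theta_h, neg_one_smul]) hX (by norm_num)
  simpa using this

lemma f_mem : f ∈ adEigenspace h (-2) := by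
  rw [mem_adEigenspace, T.sl2.lie_lie_smul_f ℝ, neg_smul]

/-- Expand `(1 + ½ D)² = 1` for `D = (ad (e - f))²`. -/
lemma lie_four (X : L) : ⁅e - f, ⁅e - f, ⁅e - f, ⁅e - f, X⁆⁆⁆⁆ =
    -(4 : ℝ) • ⁅e - f, ⁅e - f, X⁆⁆ := by
  have h1 := T.involutive X
  rw [T.theta_eq (θ X), T.theta_eq X] at h1
  simp only [lie_add, lie_smul] at h1
  linear_combination (norm := module) (4 : ℝ) • h1

/-- The pairing between the eigenspaces for `-2` and `2` is nondegenerate. -/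
lemma eq_zero_of_killingForm {a : ℝ} {Y : L} (hY : Y ∈ adEigenspace h (-a))
    (hκ : ∀ X ∈ adEigenspace h a, killingForm ℝ L Y X = 0) : Y = 0 := by
  by_contra hne
  have h1 := T.pos Y hne
  have h2 := T.theta_mem hY
  rw [neg_neg] at h2
  rw [hκ _ h2] at h1
  simp at h1

variable [Module.Finite ℝ L]

/-- Since `θ` exchanges the eigenvalues `a` and `-a`, the bound for positive eigenvalues suffices.
-/
lemma adEigenspace_eq_bot {a : ℝ} (ha : 4 ≤ |a|) {X : L} (hX : X ∈ adEigenspace h a) : X = 0 := by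
  rcases abs_cases a with ⟨h1, _⟩ | ⟨h1, _⟩
  · exact T.sl2.eq_zero_of_lie_h T.lie_four (h1 ▸ ha) (mem_adEigenspace.1 hX)
  · have := T.sl2.eq_zero_of_lie_h T.lie_four (h1 ▸ ha) (mem_adEigenspace.1 (T.theta_mem hX))
    rw [← T.involutive X, this, map_zero]

/-- The bracket would have weight `4`, which does not occur. -/
lemma lie_eq_zero {X Y : L} (hX : X ∈ adEigenspace h 2) (hY : Y ∈ adEigenspace h 2) :
    ⁅X, Y⁆ = 0 := by
  refine T.adEigenspace_eq_bot (a := 4) (by norm_num) (mem_adEigenspace.2 ?_)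
  rw [leibniz_lie, mem_adEigenspace.1 hX, mem_adEigenspace.1 hY, smul_lie, lie_smul]
  module

/-- Weight `-4` does not occur, so `[f, Y] = 0`. This is the infinitesimal form of the openness of
the `M`-orbit of `f`. -/
lemma exists_lie_f_eq {Y : L} (hY : Y ∈ adEigenspace h (-2)) :
    ∃ X ∈ adEigenspace h 0, ⁅X, f⁆ = Y := by
  have hfY : ⁅f, Y⁆ = 0 := by
    refine T.adEigenspace_eq_bot (a := -4) (by norm_num) (mem_adEigenspace.2 ?_)
    rw [leibniz_lie, mem_adEigenspace.1 T.f_mem, mem_adEigenspace.1 hY, smul_lie, lie_smul]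
    module
  obtain ⟨X, hX, h1⟩ := T.sl2.exists_lie_f_eq (mem_adEigenspace.1 hY) hfY
  exact ⟨X, mem_adEigenspace.2 (by rw [hX, zero_smul]), h1⟩

/-- Automorphisms fixing `h` and `f` commute with `θ`. -/
lemma commute_theta {A : L ≃ₗ⁅ℝ⁆ L} (hh : A h = h) (hf : A f = f) (X : L) :
    A (θ X) = θ (A X) := by
  have t' : IsSl2Triple h (A e) f :=
    ⟨T.sl2.h_ne_zero, by
      have := congrArg A T.sl2.lie_e_f
      rwa [LieEquiv.map_lie, hh, hf] at this, by
      have := congrArg A T.sl2.lie_h_e_nsmul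
      rwa [LieEquiv.map_lie, hh, map_nsmul] at this, T.sl2.lie_h_f_nsmul⟩
  have he : A e = e := T.sl2.e_unique t'
  have hu : A (e - f) = e - f := by rw [map_sub, he, hf]
  rw [T.theta_eq, T.theta_eq, map_add, map_smul, LieEquiv.map_lie, LieEquiv.map_lie, hu]

/-- Linear forms on the eigenspace for `2` are given by the Killing form. -/
lemma exists_linearMap_killingForm :
    ∃ B : (adEigenspace h 2 →ₗ[ℝ] ℝ) →ₗ[ℝ] adEigenspace h (-2),
      ∀ l (X : adEigenspace h 2), killingForm ℝ L (B l : L) X = l X := by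
  let P : adEigenspace h (-2) →ₗ[ℝ] (adEigenspace h 2 →ₗ[ℝ] ℝ) :=
    (killingForm ℝ L).domRestrict₁₂ (adEigenspace h (-2)) (adEigenspace h 2)
  have hinj : Function.Injective P := by
    rw [injective_iff_map_eq_zero]
    intro Y hY
    exact Subtype.ext (T.eq_zero_of_killingForm Y.2 fun X hX => LinearMap.congr_fun hY ⟨X, hX⟩)
  have hdim : Module.finrank ℝ (adEigenspace h (-2)) =
      Module.finrank ℝ (adEigenspace h 2 →ₗ[ℝ] ℝ) := by
    refine le_antisymm (LinearMap.finrank_le_finrank_of_injective hinj) ?_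
    have e1 : Module.finrank ℝ (adEigenspace h 2 →ₗ[ℝ] ℝ) = Module.finrank ℝ (adEigenspace h 2) :=
      Subspace.dual_finrank_eq
    rw [e1]
    -- `θ` exchanges the two eigenspaces, which gives the remaining inequality of dimensions.
    let R : adEigenspace h 2 →ₗ[ℝ] adEigenspace h (-2) :=
      (θ : L →ₗ[ℝ] L).restrict fun X hX => T.theta_mem hX
    refine LinearMap.finrank_le_finrank_of_injective (f := R) fun X Y hXY => Subtype.ext ?_
    exact θ.injective (congrArg Subtype.val hXY)
  let E := LinearEquiv.ofInjectiveOfFinrankEq P hinj hdim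
  refine ⟨E.symm.toLinearMap, fun l X => ?_⟩
  exact LinearMap.congr_fun (E.apply_symm_apply l) X

end IsTubeTriple

end

end TubeTriples

/-! ### The global Cartan involution and the equality of `M^f` with `M ∩ K`. -/

noncomputable section CartanInvolutionOfGroup

open Set Filter Topology

variable {d : ℕ} {G : Type*} [TopologicalSpace G] [ChartedSpace (EuclideanSpace ℝ (Fin d)) G]
  [Group G] [LieGroup (𝓡 d) ∞ G] {K : Subgroup G} {Θ : G →* G}

local notation "𝔤" => GroupLieAlgebra (𝓡 d) G

namespace IsCartanInvolution

/-- A global Cartan involution as an automorphism of the group. -/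
def mulEquiv (hΘ : IsCartanInvolution d K Θ) : G ≃* G where
  toFun := Θ
  invFun := Θ
  left_inv := hΘ.involutive
  right_inv := hΘ.involutive
  map_mul' := map_mul Θ

lemma mdifferentiable (hΘ : IsCartanInvolution d K Θ) : MDifferentiable (𝓡 d) (𝓡 d) Θ :=
  hΘ.contMDiff.mdifferentiable (by simp)

lemma diffOne_diffOne (hΘ : IsCartanInvolution d K Θ) (X : 𝔤) :
    diffOne d Θ (diffOne d Θ X) = X := by
  rw [← diffOne_comp Θ Θ hΘ.mdifferentiable hΘ.mdifferentiable]
  have : Θ.comp Θ = MonoidHom.id G := by ext x; exact hΘ.involutive x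
  rw [this, diffOne_id]

/-- The infinitesimal Cartan involution. -/
def lieEquiv (hΘ : IsCartanInvolution d K Θ) : 𝔤 ≃ₗ⁅ℝ⁆ 𝔤 where
  toFun := diffOne d Θ
  map_add' := map_add _
  map_smul' := map_smul _
  map_lie' := diffOne_lie hΘ.mulEquiv hΘ.contMDiff hΘ.contMDiff _ _
  invFun := diffOne d Θ
  left_inv := hΘ.diffOne_diffOne
  right_inv := hΘ.diffOne_diffOne

lemma diffOne_Ad (hΘ : IsCartanInvolution d K Θ) (g : G) (X : 𝔤) :
    diffOne d Θ (Ad d g X) = Ad d (Θ g) (diffOne d Θ X) := by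
  rw [Ad_eq_diffOne, Ad_eq_diffOne, ← diffOne_comp _ _ hΘ.mdifferentiable (mdiff_conj g),
    ← diffOne_comp _ _ (mdiff_conj _) hΘ.mdifferentiable]
  congr 2
  ext x
  simp

variable [T2Space G]

lemma mem_of_isExpCurve (hΘ : IsCartanInvolution d K Θ) {X : 𝔤} (hX : diffOne d Θ X = X)
    {γ : ℝ → G} (hγ : IsExpCurve X γ) (t : ℝ) : γ t ∈ K := by
  have h1 := hγ.map Θ hΘ.mdifferentiable
  rw [hX] at h1
  exact (hΘ.mem_iff _).2 (congrFun (h1.unique hγ) t)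

/-- An element whose image under the Cartan involution has the same adjoint action lies in the
maximal compact subgroup `K`. -/
lemma mem_of_commute [ConnectedSpace G] (hΘ : IsCartanInvolution d K Θ)
    (hcenter : Finite (Subgroup.center G)) (hK : IsMaximalCompact K) {m : G}
    (hm : ∀ X : 𝔤, Ad d m (diffOne d Θ X) = diffOne d Θ (Ad d m X)) : m ∈ K := by
  have := topologicalGroup_of_lieGroup (I := 𝓡 d) (n := ∞) (G := G)
  have hz : m⁻¹ * Θ m ∈ Subgroup.center G := by
    refine mem_center_of_Ad_eq_id (d := d) fun X => ?_
    rw [Ad_mul_apply, ← hΘ.diffOne_diffOne X, ← hΘ.diffOne_Ad, ← hm, Ad_inv_apply_Ad]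
  -- Each fiber of `g ↦ g⁻¹ Θ(g)` is closed and lies in a right coset of `K`, so `K'` is a finite
  -- union of compact sets indexed by the center; maximality of `K` then gives `K' = K`.
  let K' : Subgroup G :=
    { carrier := {g | g⁻¹ * Θ g ∈ Subgroup.center G}
      one_mem' := by simp
      mul_mem' := by
        intro a b ha hb
        have : (a * b)⁻¹ * Θ (a * b) = (a⁻¹ * Θ a) * (b⁻¹ * Θ b) := by
          rw [map_mul, mul_inv_rev, mul_assoc b⁻¹, ← mul_assoc a⁻¹, ← mul_assoc,
            Subgroup.mem_center_iff.1 ha b⁻¹, mul_assoc]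
        rw [mem_ofPred_eq, this]
        exact mul_mem ha hb
      inv_mem' := by
        intro a ha
        have : a⁻¹⁻¹ * Θ a⁻¹ = (a⁻¹ * Θ a)⁻¹ := by
          have h1 := Subgroup.mem_center_iff.1 ha a
          rw [mul_inv_cancel_left] at h1
          generalize a⁻¹ * Θ a = c at h1 ⊢
          rw [map_inv, h1, mul_inv_rev, inv_inv, mul_inv_cancel_left]
        rw [mem_ofPred_eq, this]
        exact inv_mem ha }
  have hKK' : K ≤ K' := fun k hk => by
    change k⁻¹ * Θ k ∈ Subgroup.center G
    rw [(hΘ.mem_iff k).1 hk, inv_mul_cancel]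
    exact Subgroup.one_mem _
  have hcompact : IsCompact (K' : Set G) := by
    have hKc : IsCompact (K : Set G) := hK.prop
    have hex : ∀ z : Subgroup.center G, ∃ g : G, ∀ k ∈ K', k⁻¹ * Θ k = z →
        k ∈ (· * g) '' (K : Set G) := by
      intro z
      by_cases hne : ∃ g ∈ K', g⁻¹ * Θ g = z
      · obtain ⟨g, -, hg⟩ := hne
        refine ⟨g, fun k _ hk => ⟨k * g⁻¹, ?_, by simp⟩⟩
        rw [SetLike.mem_coe, hΘ.mem_iff, map_mul, map_inv]
        rw [inv_mul_eq_iff_eq_mul] at hg hk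
        rw [hg, hk]
        group
      · exact ⟨1, fun k hk' hk => absurd ⟨k, hk', hk⟩ hne⟩
    choose g hg using hex
    have hunion : IsCompact (⋃ z, (· * g z) '' (K : Set G)) :=
      isCompact_iUnion fun z => hKc.image (continuous_mul_const (g z))
    have heq : (K' : Set G) = ⋃ z, ((· * g z) '' (K : Set G)) ∩ {k | k⁻¹ * Θ k = z} := by
      ext k
      constructor
      · intro hk
        exact mem_iUnion.2 ⟨⟨_, hk⟩, hg ⟨_, hk⟩ k hk rfl, rfl⟩
      · intro hk
        obtain ⟨z, -, hz⟩ := mem_iUnion.1 hk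
        change k⁻¹ * Θ k ∈ Subgroup.center G
        rw [show k⁻¹ * Θ k = z from hz]
        exact z.2
    rw [heq]
    refine isCompact_iUnion fun z => (hKc.image (continuous_mul_const (g z))).inter_right ?_
    exact isClosed_eq (continuous_inv.mul hΘ.contMDiff.continuous) continuous_const
  exact hK.le_of_ge hcompact hKK' hz

end IsCartanInvolution

namespace IsTubeTypeTDS

variable {H : Subgroup G} {h e f : GroupLieAlgebra (𝓡 d) G}

lemma exists_isExpCurve_center (hT : IsTubeTypeTDS (d := d) K Θ H h e f) :
    ∃ γ : ℝ → G, IsExpCurve (d := d) (e - f) γ ∧ ∀ t, ∀ k ∈ K, Commute k (γ t) := by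
  have h1 : e - f ∈ lieOf d (H ⊓ K) := by
    rw [← hT.span_compact]
    exact Submodule.mem_span_singleton_self _
  obtain ⟨γ, hγ, hmem⟩ := h1
  refine ⟨γ, hγ, fun t k hk => ?_⟩
  obtain ⟨z, hz, hzt⟩ := hT.le_center (hmem t)
  have := Subgroup.mem_center_iff.1 hz ⟨k, hk⟩
  rw [← hzt]
  exact congrArg Subtype.val this

/-- Exponentials of `θ`-fixed vectors lie in `K`, hence commute with `exp (t (e - f))`, so `e - f`
centralizes the compact part, as `cartanInvolution_eq` requires. -/
lemma isTubeTriple [T2Space G] (hT : IsTubeTypeTDS (d := d) K Θ H h e f)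
    (hΘ : IsCartanInvolution d K Θ) (hsimple : LieAlgebra.IsSimple ℝ 𝔤) :
    IsTubeTriple hΘ.lieEquiv h e f where
  sl2 := hT.sl2
  involutive := hΘ.diffOne_diffOne
  pos := hΘ.posDef
  f_eq := hT.f_eq
  theta_eq := by
    refine cartanInvolution_eq hsimple hΘ.diffOne_diffOne hΘ.posDef (fun Z hZ => ?_)
      hT.sl2.h_ne_zero (theta_h_of_f_eq hT.sl2 hΘ.diffOne_diffOne hT.f_eq)
      (lie_sub_lie_sub_h hT.sl2)
    obtain ⟨γ, hγ, hc⟩ := hT.exists_isExpCurve_center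
    obtain ⟨γ', hγ'⟩ := exists_isExpCurve (G := G) Z
    exact lie_eq_zero_of_commute hγ hγ' fun s t =>
      (hc s _ (hΘ.mem_of_isExpCurve hZ hγ' t)).symm

/-- Commuting with `exp (t (e - f))`, `m` fixes `e - f`; fixing `h` too, it fixes `[h, e - f] = 2 (e
+ f)`, and `f` is a combination of these vectors. -/
lemma Ad_f_eq_of_mem [T2Space G] (hT : IsTubeTypeTDS (d := d) K Θ H h e f) {m : G}
    (hm : m ∈ leviM (d := d) h) (hmK : m ∈ K) :
    Ad d m f = f := by
  obtain ⟨γ, hγ, hc⟩ := hT.exists_isExpCurve_center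
  have h1 : AdEquiv m (e - f) = e - f := hγ.Ad_eq_self fun t => hc t m hmK
  have hh : AdEquiv m h = h := hm
  have h2 : ⁅h, e - f⁆ = (2 : ℝ) • (e + f) := by
    rw [lie_sub, hT.sl2.lie_h_e_smul ℝ, hT.sl2.lie_lie_smul_f ℝ]
    module
  have h3 : AdEquiv m ((2 : ℝ) • (e + f)) = (2 : ℝ) • (e + f) := by
    rw [← h2, LieEquiv.map_lie, hh, h1]
  have h4 : f = (1 / 4 : ℝ) • ((2 : ℝ) • (e + f)) - (1 / 2 : ℝ) • (e - f) := by module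
  change AdEquiv m f = f
  conv_lhs => rw [h4]
  conv_rhs => rw [h4]
  rw [map_sub, map_smul _ (1 / 4 : ℝ), map_smul _ (1 / 2 : ℝ), h1, h3]

lemma mem_of_Ad_f_eq [ConnectedSpace G] [T2Space G] (hT : IsTubeTypeTDS (d := d) K Θ H h e f)
    (hΘ : IsCartanInvolution d K Θ) (hsimple : LieAlgebra.IsSimple ℝ 𝔤)
    (hcenter : Finite (Subgroup.center G)) (hK : IsMaximalCompact K)
    {m : G} (hm : m ∈ leviM (d := d) h) (hmf : Ad d m f = f) : m ∈ K :=
  hΘ.mem_of_commute hcenter hK fun X =>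
    (hT.isTubeTriple hΘ hsimple).commute_theta (A := AdEquiv m) hm hmf X

end IsTubeTypeTDS

lemma isClosed_leviM (h : 𝔤) : IsClosed (leviM (d := d) h : Set G) := by
  have := topologicalGroup_of_lieGroup (I := 𝓡 d) (n := ∞) (G := G)
  have hc : Continuous fun g : G => modelAd (d := d) g h :=
    continuous_modelAd.clm_apply continuous_const
  exact isClosed_singleton.preimage (X := G) (Y := EuclideanSpace ℝ (Fin d)) hc

end CartanInvolutionOfGroup

/-! ### Local openness of orbit maps. -/

section ExponentialOrbits

open Set Filter Topology

/-- The orbit map `X ↦ exp (b X) f` is locally open onto the affine subspace `f + W` as soon as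
its derivative at `0` is onto `W`. -/
lemma setOf_exp_apply_eq_mem_nhds_zero {E : Type*} [NormedAddCommGroup E] [NormedSpace ℝ E]
    [FiniteDimensional ℝ E] (b : E →L[ℝ] E →L[ℝ] E) (f : E) (V W : Submodule ℝ E)
    (hsurj : ∀ Y ∈ W, ∃ X ∈ V, b X f = Y)
    (hmem : ∀ X ∈ V, NormedSpace.exp (b X) f - f ∈ W) :
    {w : W | ∃ X ∈ V, NormedSpace.exp (b X) f = f + w} ∈ 𝓝 0 := by
  have := FiniteDimensional.complete ℝ E
  -- Composing with a projection onto `W` makes the derivative surjective; by `hmem` it does not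
  -- change the displacements.
  obtain ⟨π, hπ⟩ := LinearMap.exists_leftInverse_of_injective W.subtype W.ker_subtype
  have hπW (w : W) : π.toContinuousLinearMap (w : E) = w := LinearMap.congr_fun hπ w
  have h1 : HasStrictFDerivAt (NormedSpace.exp : (E →L[ℝ] E) → E →L[ℝ] E)
      (1 : (E →L[ℝ] E) →L[ℝ] E →L[ℝ] E) ((b.comp V.subtypeL) 0) := by
    rw [map_zero]
    exact hasStrictFDerivAt_exp_zero
  have h2 : HasStrictFDerivAt (fun X : V => NormedSpace.exp (b X) f)
      ((ContinuousLinearMap.apply ℝ E f).comp (b.comp V.subtypeL)) 0 :=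
    (ContinuousLinearMap.apply ℝ E f).hasStrictFDerivAt.comp 0
      (h1.comp 0 (b.comp V.subtypeL).hasStrictFDerivAt)
  have h3 : HasStrictFDerivAt
      (fun X : V => π.toContinuousLinearMap (NormedSpace.exp (b X) f - f))
      (π.toContinuousLinearMap.comp
        ((ContinuousLinearMap.apply ℝ E f).comp (b.comp V.subtypeL))) 0 :=
    π.toContinuousLinearMap.hasStrictFDerivAt.comp 0 (h2.sub_const f)
  have h4 := h3.map_nhds_eq_of_surj (LinearMap.range_eq_top.2 fun w => by
    obtain ⟨X, hX, hXw⟩ := hsurj w w.2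
    refine ⟨⟨X, hX⟩, ?_⟩
    change π.toContinuousLinearMap (b X f) = w
    rw [hXw, hπW])
  have h5 : π.toContinuousLinearMap (NormedSpace.exp (b ((0 : V) : E)) f - f) = 0 := by simp
  rw [h5] at h4
  refine mem_of_superset (h4 ▸ image_mem_map univ_mem) ?_
  rintro w ⟨X, -, rfl⟩
  have h6 := congrArg Subtype.val (hπW ⟨_, hmem X X.2⟩)
  exact ⟨X, X.2, eq_add_of_sub_eq' h6.symm⟩

lemma eq_add_of_hasDerivAt_const {E : Type*} [NormedAddCommGroup E] [NormedSpace ℝ E] {c : ℝ → E}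
    {v : E} (hc : ∀ t, HasDerivAt c v t) : c 1 = c 0 + v := by
  have hd (t : ℝ) : HasDerivAt (fun s => c s - s • v) 0 t := by
    have h1 := (hc t).sub ((hasDerivAt_id t).smul_const v)
    rw [one_smul, sub_self] at h1
    exact h1
  have hconst := is_const_of_deriv_eq_zero (fun t => (hd t).differentiableAt)
    (fun t => (hd t).deriv) 1 0
  simp only [one_smul, zero_smul, sub_zero] at hconst
  exact eq_add_of_sub_eq hconst

end ExponentialOrbits

/-! ### The exponential map of the group. -/

noncomputable section ExponentialMap

open Set Filter Topology

variable {d : ℕ} {G : Type*} [TopologicalSpace G] [ChartedSpace (EuclideanSpace ℝ (Fin d)) G]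
  [Group G] [LieGroup (𝓡 d) ∞ G]

local notation "𝔤" => GroupLieAlgebra (𝓡 d) G
local notation "𝔼" => EuclideanSpace ℝ (Fin d)
local notation "κ" => killingForm ℝ (GroupLieAlgebra (𝓡 d) G)

lemma killingForm_Ad (g : G) (X Y : 𝔤) : κ (Ad d g X) (Ad d g Y) = κ X Y :=
  LieAlgebra.killingForm_of_equiv_apply (AdEquiv g) X Y

lemma Ad_mem_adEigenspace {h : 𝔤} {m : G} (hm : m ∈ leviM (d := d) h) {a : ℝ} {X : 𝔤}
    (hX : X ∈ adEigenspace h a) : Ad d m X ∈ adEigenspace h a := by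
  have := map_mem_adEigenspace (AdEquiv m) (b := 1) (by rw [one_smul]; exact hm) hX (by norm_num)
  rwa [one_mul] at this

lemma inv_mem_leviM {h : 𝔤} {m : G} (hm : m ∈ leviM (d := d) h) : m⁻¹ ∈ leviM (d := d) h := by
  change Ad d m⁻¹ h = h
  conv_lhs => rw [← show Ad d m h = h from hm]
  exact Ad_inv_apply_Ad m h

lemma mul_mem_leviM {h : 𝔤} {m m' : G} (hm : m ∈ leviM (d := d) h)
    (hm' : m' ∈ leviM (d := d) h) : m * m' ∈ leviM (d := d) h := by
  change Ad d (m * m') h = h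
  rw [Ad_mul_apply, show Ad d m' h = h from hm', show Ad d m h = h from hm]

variable [T2Space G]

/-- The exponential map. -/
def expMap (X : 𝔤) : G := (exists_isExpCurve X).choose 1

lemma IsExpCurve.apply_one {X : 𝔤} {γ : ℝ → G} (hγ : IsExpCurve X γ) : γ 1 = expMap X :=
  congrFun (hγ.unique (exists_isExpCurve X).choose_spec) 1

lemma IsExpCurve.eq_expMap_smul {X : 𝔤} {γ : ℝ → G} (hγ : IsExpCurve X γ) (s : ℝ) :
    γ s = expMap (s • X) := by
  simpa using (hγ.smul s).apply_one

lemma isExpCurve_expMap (X : 𝔤) : IsExpCurve X (fun s : ℝ => expMap (s • X)) := by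
  obtain ⟨γ, hγ⟩ := exists_isExpCurve (G := G) X
  rwa [← funext hγ.eq_expMap_smul]

lemma isExp_iff {X : 𝔤} {g : G} : IsExp X g ↔ g = expMap X := by
  constructor
  · rintro ⟨γ, hγ, rfl⟩
    exact hγ.apply_one
  · rintro rfl
    exact ⟨_, isExpCurve_expMap X, by rw [one_smul]⟩

lemma expMap_zero : expMap (0 : 𝔤) = 1 := by
  simpa using (isExpCurve_expMap (0 : 𝔤)).1

lemma conj_expMap (g : G) (X : 𝔤) : g * expMap X * g⁻¹ = expMap (Ad d g X) := by
  simpa using ((isExpCurve_expMap X).conj g).apply_one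

lemma Ad_expMap_eq_of_lie_eq_zero {X Y : 𝔤} (hXY : ⁅X, Y⁆ = 0) : Ad d (expMap X) Y = Y := by
  simpa using (isExpCurve_expMap X).Ad_eq_of_lie_eq_zero hXY 1

lemma modelAd_expMap (X : 𝔤) :
    modelAd (d := d) (expMap X) = NormedSpace.exp (bracketL d G X) := by
  simpa using (isExpCurve_expMap X).modelAd_eq 1

lemma expMap_add {X Y : 𝔤} (hXY : ⁅X, Y⁆ = 0) : expMap (X + Y) = expMap X * expMap Y := by
  have := ((isExpCurve_expMap X).add (isExpCurve_expMap Y) fun s t =>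
    (isExpCurve_expMap Y).commute ((isExpCurve_expMap X).Ad_eq_of_lie_eq_zero hXY s) t).apply_one
  simpa using this.symm

/-- The derivative of `s ↦ Ad (exp (s X)) h` is `Ad (exp (s X)) [X, h] = -2 X`, constant because
`exp (s X)` fixes `X`. -/
lemma Ad_expMap_h {h X : 𝔤} (hX : X ∈ adEigenspace h 2) :
    Ad d (expMap X) h = h - (2 : ℝ) • X := by
  have hX' : ⁅X, h⁆ = (-2 : ℝ) • X := by
    rw [← lie_skew, mem_adEigenspace.1 hX, neg_smul]
  have hd (t : ℝ) : HasDerivAt (F := 𝔼) (fun s => Ad d (expMap (s • X)) h) ((-2 : ℝ) • X) t := by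
    have h1 := (isExpCurve_expMap X).hasDerivAt_Ad h t
    rwa [hX', map_smul, (isExpCurve_expMap X).Ad_eq_of_lie_eq_zero (lie_self X)] at h1
  have h1 : Ad d (expMap ((1 : ℝ) • X)) h = Ad d (expMap ((0 : ℝ) • X)) h + (-2 : ℝ) • X :=
    eq_add_of_hasDerivAt_const (E := 𝔼) hd
  rw [one_smul, zero_smul, expMap_zero, Ad_one_apply] at h1
  rw [h1, neg_smul, sub_eq_add_neg]

end ExponentialMap

/-! ### The abelian group `N` and its characters. -/

noncomputable section UnipotentRadical

open Set Filter Topology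

variable {d : ℕ} {G : Type*} [TopologicalSpace G] [ChartedSpace (EuclideanSpace ℝ (Fin d)) G]
  [Group G] [LieGroup (𝓡 d) ∞ G] [T2Space G]

local notation "𝔤" => GroupLieAlgebra (𝓡 d) G
local notation "𝔼" => EuclideanSpace ℝ (Fin d)
local notation "κ" => killingForm ℝ (GroupLieAlgebra (𝓡 d) G)

lemma expMap_mem_groupN {h X : GroupLieAlgebra (𝓡 d) G} (hX : X ∈ adEigenspace h 2) :
    expMap X ∈ groupN (d := d) h :=
  Subgroup.subset_closure ⟨X, mem_adEigenspace.1 hX, isExp_iff.2 rfl⟩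

/-- The exponential map of `N`. -/
def expN (h : GroupLieAlgebra (𝓡 d) G) (X : adEigenspace h 2) : groupN (d := d) h :=
  ⟨expMap (X : GroupLieAlgebra (𝓡 d) G), expMap_mem_groupN X.2⟩

lemma continuous_expN_smul (h : GroupLieAlgebra (𝓡 d) G) (X : adEigenspace h 2) :
    Continuous fun s : ℝ => expN h (s • X) :=
  (isExpCurve_expMap (X : GroupLieAlgebra (𝓡 d) G)).continuous.subtype_mk _

lemma isCharacterOf_iff {h f : GroupLieAlgebra (𝓡 d) G} {t : ℝ}
    {χ : PontryaginDual (groupN (d := d) h)} :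
    IsCharacterOf h f t χ ↔ ∀ X : adEigenspace h 2, χ (expN h X) = Circle.exp (t * κ f X) := by
  constructor
  · exact fun H X => H X (mem_adEigenspace.1 X.2) _ (isExp_iff.2 rfl)
  · intro H X hX n hn
    have e : n = expN h ⟨X, mem_adEigenspace.2 hX⟩ := Subtype.ext (isExp_iff.1 hn)
    rw [e, H]

/-- Half the displacement of `h` under the adjoint action: the inverse of the exponential map
of `N`. -/
def logN (h : GroupLieAlgebra (𝓡 d) G) (g : G) : GroupLieAlgebra (𝓡 d) G :=
  (1 / 2 : ℝ) • (h - Ad d g h)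

lemma logN_expMap {h X : GroupLieAlgebra (𝓡 d) G} (hX : X ∈ adEigenspace h 2) :
    logN h (expMap X) = X := by
  rw [logN, Ad_expMap_h hX]
  module

section Abelian

variable {h : GroupLieAlgebra (𝓡 d) G}
  (hab : ∀ X ∈ adEigenspace h 2, ∀ Y ∈ adEigenspace h 2, ⁅X, Y⁆ = 0)
include hab

lemma expN_add (X Y : adEigenspace h 2) : expN h (X + Y) = expN h X * expN h Y :=
  Subtype.ext (expMap_add (hab X X.2 Y Y.2))

lemma expN_surjective : Function.Surjective (expN h) := by
  rintro ⟨g, hg⟩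
  suffices hs : ∃ X ∈ adEigenspace h 2, expMap X = g by
    obtain ⟨X, hX, rfl⟩ := hs
    exact ⟨⟨X, hX⟩, rfl⟩
  refine Subgroup.closure_induction (p := fun g _ => ∃ X ∈ adEigenspace h 2, expMap X = g)
    ?_ ?_ ?_ ?_ hg
  · rintro g ⟨X, hX, hg⟩
    exact ⟨X, mem_adEigenspace.2 hX, (isExp_iff.1 hg).symm⟩
  · exact ⟨0, zero_mem _, expMap_zero⟩
  · rintro _ _ _ _ ⟨X, hX, rfl⟩ ⟨Y, hY, rfl⟩
    exact ⟨X + Y, add_mem hX hY, expMap_add (hab X hX Y hY)⟩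
  · rintro _ _ ⟨X, hX, rfl⟩
    refine ⟨-X, neg_mem hX, eq_inv_of_mul_eq_one_left ?_⟩
    rw [← expMap_add (hab _ (neg_mem hX) X hX), neg_add_cancel, expMap_zero]

/-- The characters of `N` are determined by linear forms on its Lie algebra. -/
lemma existsUnique_isCharacterOf (f : GroupLieAlgebra (𝓡 d) G) (t : ℝ) :
    ∃! χ : PontryaginDual (groupN (d := d) h), IsCharacterOf h f t χ := by
  have := topologicalGroup_of_lieGroup (I := 𝓡 d) (n := ∞) (G := G)
  -- `logN` is given by a formula continuous on all of `G`, so `c` is well defined and continuous on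
  -- `N` with its subspace topology.
  let c (n : groupN (d := d) h) : Circle := Circle.exp (t * κ f (logN h (n : G)))
  have hc (X : adEigenspace h 2) : c (expN h X) = Circle.exp (t * κ f X) := by
    change Circle.exp (t * κ f (logN h (expMap (X : 𝔤)))) = _
    rw [logN_expMap X.2]
  have hcont : Continuous c := by
    let h' : 𝔼 := h
    have h1 : Continuous fun g : G => modelAd (d := d) g h' :=
      continuous_modelAd.clm_apply continuous_const
    have h2 : Continuous fun g : G => (1 / 2 : ℝ) • (h' - modelAd (d := d) g h') := by
      fun_prop
    let l : 𝔼 →ₗ[ℝ] ℝ := κ f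
    have h3 : Continuous l := l.continuous_of_finiteDimensional
    exact Circle.exp.continuous.comp
      (continuous_const.mul (h3.comp (h2.comp continuous_subtype_val)))
  let χ : PontryaginDual (groupN (d := d) h) :=
    { toFun := c
      map_one' := by
        have e : (1 : groupN (d := d) h) = expN h 0 := Subtype.ext expMap_zero.symm
        rw [e, hc]
        simp
      map_mul' := by
        intro n n'
        obtain ⟨X, rfl⟩ := expN_surjective hab n
        obtain ⟨Y, rfl⟩ := expN_surjective hab n'
        rw [← expN_add hab, hc, hc, hc, ← Circle.exp_add, Submodule.coe_add, map_add, mul_add]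
      continuous_toFun := hcont }
  refine ⟨χ, isCharacterOf_iff.2 hc, fun ψ hψ => ?_⟩
  ext n
  obtain ⟨X, rfl⟩ := expN_surjective hab n
  rw [isCharacterOf_iff.1 hψ X]
  exact congrArg _ (hc X).symm

lemma isConjBy_iff {m : G} (hm : m ∈ leviM (d := d) h) {χ ψ : PontryaginDual (groupN (d := d) h)} :
    IsConjBy h m χ ψ ↔ ∀ X : adEigenspace h 2,
      ψ (expN h X) = χ (expN h ⟨Ad d m X, Ad_mem_adEigenspace hm X.2⟩) := by
  have key (X : adEigenspace h 2) : m * (expN h X : G) * m⁻¹ =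
      expN h ⟨Ad d m X, Ad_mem_adEigenspace hm X.2⟩ := conj_expMap m (X : 𝔤)
  constructor
  · intro H X
    obtain ⟨hn, e⟩ := H (expN h X)
    rw [e]
    exact congrArg χ (Subtype.ext (key X))
  · intro H n
    obtain ⟨X, rfl⟩ := expN_surjective hab n
    refine ⟨by rw [key]; exact Subtype.property _, ?_⟩
    rw [H]
    exact congrArg χ (Subtype.ext (key X).symm)

end Abelian

end UnipotentRadical

/-! ### Open orbits and stabilizers of characters. -/

noncomputable section GenericCharacters

open Set Filter Topology

variable {d : ℕ} {G : Type*} [TopologicalSpace G] [ChartedSpace (EuclideanSpace ℝ (Fin d)) G]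
  [Group G] [LieGroup (𝓡 d) ∞ G] [T2Space G]

local notation "𝔤" => GroupLieAlgebra (𝓡 d) G
local notation "𝔼" => EuclideanSpace ℝ (Fin d)
local notation "κ" => killingForm ℝ (GroupLieAlgebra (𝓡 d) G)

namespace IsTubeTriple

variable {h e f : GroupLieAlgebra (𝓡 d) G}
  {θ : GroupLieAlgebra (𝓡 d) G ≃ₗ⁅ℝ⁆ GroupLieAlgebra (𝓡 d) G} (T : IsTubeTriple θ h e f)
include T

/-- The orbit of `f` under the Levi factor `M` is a neighborhood of `f` in the eigenspace. -/
lemma setOf_Ad_f_eq_mem_nhds_zero :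
    {w : adEigenspace h (-2) | ∃ m ∈ leviM (d := d) h, Ad d m f = f + w} ∈ 𝓝 0 := by
  have hM {X : 𝔤} (hX : X ∈ adEigenspace h 0) : expMap X ∈ leviM (d := d) h := by
    refine Ad_expMap_eq_of_lie_eq_zero ?_
    rw [← lie_skew, mem_adEigenspace.1 hX, zero_smul, neg_zero]
  have hAd (X : 𝔤) : NormedSpace.exp (bracketL d G X) f = Ad d (expMap X) f :=
    congrArg (fun A : 𝔼 →L[ℝ] 𝔼 => A f) (modelAd_expMap X).symm
  let f' : 𝔼 := f
  have hAd' (X : 𝔤) (hX : X ∈ adEigenspace h 0) :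
      NormedSpace.exp (bracketL d G X) f' - f' ∈ (adEigenspace h (-2) : Set 𝔤) := by
    have h1 : Ad d (expMap X) f - f ∈ adEigenspace h (-2) :=
      sub_mem (Ad_mem_adEigenspace (hM hX) T.f_mem) T.f_mem
    rw [← hAd X] at h1
    exact h1
  have key := setOf_exp_apply_eq_mem_nhds_zero (E := 𝔼) (bracketL d G) f' (adEigenspace h 0)
    (adEigenspace h (-2))
    (fun Y hY => by
      obtain ⟨X, hX, hXY⟩ := T.exists_lie_f_eq hY
      exact ⟨X, hX, (bracketL_apply X f).trans hXY⟩)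
    (fun X hX => hAd' X hX)
  refine mem_of_superset key ?_
  rintro w ⟨X, hX, hw⟩
  exact ⟨expMap X, hM hX, (hAd X).symm.trans hw⟩

lemma isGenericCharacter {t : ℝ} (ht : t ≠ 0) {χ : PontryaginDual (groupN (d := d) h)}
    (hχ : IsCharacterOf h f t χ) : IsGenericCharacter h χ := by
  have := topologicalGroup_of_lieGroup (I := 𝓡 d) (n := ∞) (G := G)
  have hab : ∀ X ∈ adEigenspace h 2, ∀ Y ∈ adEigenspace h 2, ⁅X, Y⁆ = 0 :=
    fun X hX Y hY => T.lie_eq_zero hX hY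
  rw [isCharacterOf_iff] at hχ
  refine isOpen_iff_mem_nhds.2 ?_
  rintro ψ₀ ⟨m₀, hm₀, hψ₀⟩
  rw [isConjBy_iff hab hm₀] at hψ₀
  obtain ⟨B, hB⟩ := T.exists_linearMap_killingForm
  let A : adEigenspace h (-2) →ₗ[ℝ] adEigenspace h (-2) :=
    LinearMap.restrict ((AdEquiv m₀ : 𝔤 ≃ₗ⁅ℝ⁆ 𝔤) : 𝔤 →ₗ[ℝ] 𝔤) fun X hX => Ad_mem_adEigenspace hm₀ hX
  -- For `ψ = ψ₀ · exp (i l)` with `l` small, `t⁻¹ Ad(m₀) B(l)` is small enough to equal `Ad(m₁) f -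
  -- f`; invariance of the Killing form then shows that `m₁⁻¹ m₀` carries `χ` to `ψ`.
  have hnhds := PontryaginDual.setOf_exp_mem_nhds_one (ex := expN h) (continuous_expN_smul h)
    (expN_add hab) (t⁻¹ • A ∘ₗ B) T.setOf_Ad_f_eq_mem_nhds_zero
  have hmul : Tendsto (fun ψ => ψ₀⁻¹ * ψ) (𝓝 ψ₀) (𝓝 1) := by
    rw [← inv_mul_cancel ψ₀]
    exact (continuous_const_mul ψ₀⁻¹).tendsto ψ₀
  filter_upwards [hmul hnhds] with ψ hψ
  obtain ⟨l, ⟨m₁, hm₁, hm₁f⟩, hl⟩ := hψ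
  have hm : m₁⁻¹ * m₀ ∈ leviM (d := d) h := mul_mem_leviM (inv_mem_leviM hm₁) hm₀
  refine ⟨m₁⁻¹ * m₀, hm, (isConjBy_iff hab hm).2 fun X => ?_⟩
  have e1 : ψ (expN h X) = ψ₀ (expN h X) * Circle.exp (l X) := by
    rw [← hl]
    exact (mul_inv_cancel_left (ψ₀ (expN h X)) (ψ (expN h X))).symm
  have e2 : κ f (Ad d (m₁⁻¹ * m₀) X) = κ f (Ad d m₀ X) + t⁻¹ * l X := by
    rw [Ad_mul_apply, ← killingForm_Ad m₁, Ad_apply_Ad_inv, hm₁f, map_add, LinearMap.add_apply]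
    congr 1
    change κ (t⁻¹ • Ad d m₀ (B l)) (Ad d m₀ X) = _
    rw [map_smul, LinearMap.smul_apply, killingForm_Ad, hB, smul_eq_mul]
  rw [e1, hψ₀, hχ, hχ, ← Circle.exp_add]
  congr 1
  rw [e2, mul_add, mul_inv_cancel_left₀ ht]

lemma mem_charStabilizer_iff {t : ℝ} (ht : t ≠ 0) {χ : PontryaginDual (groupN (d := d) h)}
    (hχ : IsCharacterOf h f t χ) {m : G} :
    m ∈ charStabilizer h χ ↔ m ∈ leviM (d := d) h ∧ Ad d m f = f := by
  have hab : ∀ X ∈ adEigenspace h 2, ∀ Y ∈ adEigenspace h 2, ⁅X, Y⁆ = 0 :=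
    fun X hX Y hY => T.lie_eq_zero hX hY
  rw [isCharacterOf_iff] at hχ
  refine and_congr_right fun hm => ?_
  rw [isConjBy_iff hab hm]
  constructor
  · intro H
    have hm' := inv_mem_leviM hm
    have key (X : 𝔤) (hX : X ∈ adEigenspace h 2) : κ (Ad d m⁻¹ f - f) X = 0 := by
      have h1 : t * κ f X = t * κ f (Ad d m X) := by
        -- Testing on all multiples `s X` removes the ambiguity modulo `2π`.
        refine Circle.eq_of_forall_exp_mul_eq fun s => ?_
        have h2 := H (s • ⟨X, hX⟩)
        rw [hχ, hχ] at h2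
        simp only [Submodule.coe_smul, map_smul, smul_eq_mul] at h2
        rw [mul_assoc, mul_assoc, mul_comm _ s, mul_comm _ s]
        exact h2
      rw [map_sub, LinearMap.sub_apply, ← killingForm_Ad m, Ad_apply_Ad_inv,
        ← mul_left_cancel₀ ht h1, sub_self]
    have h3 := T.eq_zero_of_killingForm (a := 2)
      (sub_mem (Ad_mem_adEigenspace hm' T.f_mem) T.f_mem) key
    conv_lhs => rw [← sub_eq_zero.1 h3]
    exact Ad_apply_Ad_inv m f
  · intro H X
    rw [hχ, hχ]
    congr 2
    conv_rhs => rw [← H]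
    exact (killingForm_Ad m f X).symm

end IsTubeTriple

end GenericCharacters

theorem lemma1 {d : ℕ} {G : Type*} [TopologicalSpace G] [T2Space G]
    [ChartedSpace (EuclideanSpace ℝ (Fin d)) G] [Group G] [LieGroup (𝓡 d) ∞ G]
    [ConnectedSpace G]
    (hsimple : LieAlgebra.IsSimple ℝ (GroupLieAlgebra (𝓡 d) G))
    (hcenter : Finite (Subgroup.center G))
    (K : Subgroup G) (hK : IsMaximalCompact K)
    (Θ : G →* G) (hΘ : IsCartanInvolution d K Θ)
    {S : Type*} [Group S] [TopologicalSpace S] [IsTopologicalGroup S]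
    (p : S →* PSL(2, ℝ)) (hp : IsFiniteCovering p)
    (φ : S →* G) (hφ : Continuous φ)
    (h e f : GroupLieAlgebra (𝓡 d) G)
    (hTDS : IsTubeTypeTDS K Θ φ.range h e f) :
    {m | m ∈ leviM h ∧ Ad d m f = f} = leviM h ∩ (K : Set G) ∧
    IsCompact (leviM h ∩ (K : Set G)) ∧
    ∀ t : ℝ, t ≠ 0 →
      (∃! χ : PontryaginDual (groupN h), IsCharacterOf h f t χ) ∧
      ∀ χ : PontryaginDual (groupN h), IsCharacterOf h f t χ →
        IsGenericCharacter h χ ∧ charStabilizer h χ = leviM h ∩ (K : Set G) := by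
  have T := hTDS.isTubeTriple hΘ hsimple
  have key : {m | m ∈ leviM h ∧ Ad d m f = f} = leviM h ∩ (K : Set G) := by
    ext m
    refine and_congr_right fun hm => ⟨fun hf => ?_, fun hmK => ?_⟩
    · exact hTDS.mem_of_Ad_f_eq hΘ hsimple hcenter hK hm hf
    · exact hTDS.Ad_f_eq_of_mem hm hmK
  have hKc : IsCompact (K : Set G) := hK.prop
  refine ⟨key, hKc.inter_left (isClosed_leviM h), fun t ht => ⟨?_, fun χ hχ => ⟨?_, ?_⟩⟩⟩
  · exact existsUnique_isCharacterOf (fun X hX Y hY => T.lie_eq_zero hX hY) f t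
  · exact T.isGenericCharacter ht hχ
  · rw [← key]
    ext m
    exact T.mem_charStabilizer_iff ht hχ
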